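/- Let $\mathbb F$ be an algebraically closed field of characteristic $0$, and let $n\ge 1$ and $d\ge 0$ be integers. For partitions $\alpha,\beta,\gamma$ let $c^{\gamma}_{\alpha,\beta}$ be the Littlewood–Richardson coefficient, i.e. the coefficient of the Schur function $s_\gamma$ in $s_\alpha s_\beta$. For partitions $\lambda,\beta_1,\dots,\beta_n$ define the generalized Littlewood–Richardson coefficient $$c^{\lambda}_{\beta_1,\dots,\beta_n}=\sum_{\alpha_1,\dots,\alpha_{n-2}} c^{\lambda}_{\alpha_1,\beta_1}\,c^{\alpha_1}_{\alpha_2,\beta_2}\cdots c^{\alpha_{n-3}}_{\alpha_{n-2},\beta_{n-2}}\,c^{\alpha_{n-2}}_{\beta_{n-1},\beta_n}$$ (so it is the ordinary coefficient for $n=2$; for $n=1$ put $c^{\lambda}_{\beta_1}=\delta_{\lambda,\beta_1}$). Let the Type I matrix $A^n_d=(a^n_{\lambda,\mu})$, with rows and columns indexed by the partitions of $d$, be given by $$a^n_{\lambda,\mu}=\sum_{\beta_1,\dots,\beta_n} c^{\lambda}_{\beta_1,\dots,\beta_n}\,c^{\mu}_{\beta_1,\dots,\beta_n},$$ the sum being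 over all $n$-tuples of partitions. For a partition $\lambda$ of $d$ let $H_\lambda$ be the corresponding irreducible representation of the symmetric group $S_d$ over $\mathbb F$ (the left ideal of $\mathbb F[S_d]$ generated by a Young symmetrizer of shape $\lambda$), and let $\chi_\lambda$ be its character. **Theorem 9.5.** Suppose $\sigma=\sigma_1\cdots\sigma_p\in S_d$ is a product of $p$ disjoint cycles, where fixed points of $\sigma$ are counted as cycles of length $1$. Then the vector $(\chi_\lambda(\sigma))_{|\lambda|=d}$ is nonzero and is an eigenvector of $A^n_d$ with eigenvalue $n^p$: $$\sum_{|\mu|=d} a^n_{\lambda,\mu}\,\chi_\mu(\sigma)=n^{p}\,\chi_\lambda(\sigma)\qquad\text{for every partition }\lambda\text{ of }d.$$ -/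

import Mathlib

namespace TypeI

/-- Partitions of arbitrary size: `⟨m, l⟩` is the partition `l` of `m`. -/
abbrev Ptn : Type := Σ m : ℕ, Nat.Partition m

/-- The finite set of all partitions of size at most `d`. -/
def ptnsLE (d : ℕ) : Finset Ptn :=
  (Finset.range (d + 1)).sigma fun _ => Finset.univ

/-! ### Schur functions and Littlewood-Richardson coefficients -/

/-- The `i`-th part (`i = 0, 1, 2, …`) of a partition, the parts being listed in
weakly decreasing order and continued by zeros. -/
def part (l : Ptn) (i : ℕ) : ℕ :=
  (l.2.parts.sort (· ≥ ·)).getD i 0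

/-- The alternant `det (x_i ^ e_j)` in `N` variables. -/
noncomputable def alternant (N : ℕ) (e : Fin N → ℕ) : MvPolynomial (Fin N) ℤ :=
  (Matrix.of fun i j : Fin N => MvPolynomial.X i ^ e j).det

/-- The Schur function `s_l` in `N` variables, as the quotient of alternants
`det (x_i ^ (l_j + N - 1 - j)) / det (x_i ^ (N - 1 - j))` with `0 ≤ i, j < N`. It is used
only when `N` is at least the number of parts of `l`. The quotient is a symmetric polynomial;
here it is regarded as an element of the field of fractions. -/
noncomputable def schur (N : ℕ) (l : Ptn) : FractionRing (MvPolynomial (Fin N) ℤ) :=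
  algebraMap (MvPolynomial (Fin N) ℤ) (FractionRing (MvPolynomial (Fin N) ℤ))
      (alternant N fun j => part l j + (j.rev : ℕ)) /
    algebraMap (MvPolynomial (Fin N) ℤ) (FractionRing (MvPolynomial (Fin N) ℤ))
      (alternant N fun j => (j.rev : ℕ))

/-- `c` is the family of structure constants of the product `s_a * s_b`:
`s_a * s_b = ∑ c_g s_g`, where `g` runs over the partitions of `|a| + |b|`
(and `c_g = 0` for all other `g`). The identity is written in `|a| + |b|` variables, where
the Schur functions of the partitions of `|a| + |b|` form a basis of the symmetric polynomials
of degree `|a| + |b|`; so exactly one family `c` has this property. -/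
def IsSchurProduct (a b : Ptn) (c : Ptn → ℤ) : Prop :=
  (∀ g : Ptn, g.1 ≠ a.1 + b.1 → c g = 0) ∧
    schur (a.1 + b.1) a * schur (a.1 + b.1) b =
      ∑ g : Nat.Partition (a.1 + b.1), c ⟨a.1 + b.1, g⟩ • schur (a.1 + b.1) ⟨a.1 + b.1, g⟩

/-- The Littlewood-Richardson coefficient `c^g_{a,b}`: the coefficient of `s_g` in the expansion
of `s_a * s_b` in Schur functions. -/
noncomputable def lrCoeff (g a b : Ptn) : ℤ :=
  Classical.epsilon (IsSchurProduct a b) g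

/-- The generalized Littlewood-Richardson coefficient `c^g_{b_1, …, b_n}`, that is
`∑ c^g_{a_1, b_1} c^{a_1}_{a_2, b_2} ⋯ c^{a_{n-2}}_{b_{n-1}, b_n}`, summed over all partitions
`a_1, …, a_{n-2}`. A nonzero summand has `|a_{i+1}| ≤ |a_i| ≤ |g|`, so each sum may be restricted
to partitions of bounded size. For `n = 2` it is `c^g_{b_1, b_2}`, for `n = 1` it is `1` or `0`
according as `g = b_1` or not. -/
noncomputable def genLRCoeff : List Ptn → Ptn → ℤ
  | [], g => if g.1 = 0 then 1 else 0
  | [b], g => if g = b then 1 else 0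
  | [b₁, b₂], g => lrCoeff g b₁ b₂
  | b₁ :: b₂ :: b₃ :: bs, g =>
      ∑ a ∈ ptnsLE g.1, lrCoeff g a b₁ * genLRCoeff (b₂ :: b₃ :: bs) a

/-- The Type I matrix `A^n_d`, with rows and columns indexed by the partitions of `d`: its
`(l, m)` entry is the sum of `c^l_{b_1, …, b_n} * c^m_{b_1, …, b_n}` over all `n`-tuples of
partitions. A nonzero summand has `|b_1| + ⋯ + |b_n| = d`, so the sum may be restricted to
partitions of size at most `d`. -/
noncomputable def typeIMatrix (n d : ℕ) : Matrix (Nat.Partition d) (Nat.Partition d) ℤ :=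
  Matrix.of fun l m => ∑ b ∈ Fintype.piFinset fun _ : Fin n => ptnsLE d,
    genLRCoeff (List.ofFn b) ⟨d, l⟩ * genLRCoeff (List.ofFn b) ⟨d, m⟩

/-! ### The irreducible representations of the symmetric group -/

/-- The parts of `l`, in weakly decreasing order, as a composition of `d`. -/
def rowComposition {d : ℕ} (l : Nat.Partition d) : Composition d where
  blocks := l.parts.sort (· ≥ ·)
  blocks_pos := fun h => l.parts_pos ((Multiset.mem_sort _).1 h)
  blocks_sum := by
    have h := congrArg Multiset.sum (Multiset.sort_eq l.parts (· ≥ ·))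
    rw [Multiset.sum_coe] at h
    exact h.trans l.parts_sum

/-- The row of the entry `i` in the standard tableau of shape `l` whose entries are written
in increasing order along the first row, then along the second row, and so on. -/
def row {d : ℕ} (l : Nat.Partition d) (i : Fin d) : ℕ :=
  (rowComposition l).index i

/-- The column of the entry `i` in the tableau described at `row`. -/
def col {d : ℕ} (l : Nat.Partition d) (i : Fin d) : ℕ :=
  (rowComposition l).invEmbedding i

/-- The Young symmetrizer `c_l = (∑ p) * (∑ sgn(q) q)`, where `p` runs over the permutations that
preserve each row and `q` over those that preserve each column of the tableau. -/
noncomputable def youngSymmetrizer (F : Type*) [Field F] {d : ℕ} (l : Nat.Partition d) :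
    MonoidAlgebra F (Equiv.Perm (Fin d)) :=
  (∑ p : Equiv.Perm (Fin d) with ∀ i, row l (p i) = row l i, MonoidAlgebra.single p 1) *
    ∑ q : Equiv.Perm (Fin d) with ∀ i, col l (q i) = col l i,
      MonoidAlgebra.single q (((Equiv.Perm.sign q : ℤ) : F))

/-- The irreducible representation `H_l` of `S_d` attached to the partition `l` of `d`: the left
ideal `F[S_d] * c_l`, on which `S_d` acts by left multiplication. The partition `(d)` gives the
trivial representation and `(1, …, 1)` the sign representation. -/
noncomputable def spechtModule (F : Type*) [Field F] {d : ℕ} (l : Nat.Partition d) :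
    Subrepresentation (Representation.leftRegular F (Equiv.Perm (Fin d))) where
  toSubmodule := LinearMap.range (LinearMap.mulRight F (youngSymmetrizer F l))
  apply_mem_toSubmodule := by
    rintro g _ ⟨x, rfl⟩
    refine ⟨MonoidAlgebra.single g 1 * x, ?_⟩
    have key : ∀ y : MonoidAlgebra F (Equiv.Perm (Fin d)),
        Representation.leftRegular F (Equiv.Perm (Fin d)) g y = MonoidAlgebra.single g 1 * y := by
      intro y
      induction y using MonoidAlgebra.induction_linear with
      | zero => simp
      | add x y hx hy => rw [map_add, hx, hy, mul_add]
      | single h a => simp [Representation.ofMulAction_single]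
    simp [key, mul_assoc]

/-- The character value `χ_l(σ)`: the trace of `σ` on `H_l`. -/
noncomputable def irrChar (F : Type*) [Field F] {d : ℕ} (l : Nat.Partition d)
    (σ : Equiv.Perm (Fin d)) : F :=
  (spechtModule F l).toRepresentation.character σ

end TypeI

/-! Write χ_l(t) for the value of the character of `l` at cycle type t (`ch` below).
Littlewood-Richardson coefficients are multiplicities for restriction to and induction from Young
subgroups, and two identities carry the theorem. Restriction, `sum_lrCoeff_mul_ch_mul_ch`: Σ
c^g_{x,y} χ_x(r) χ_y(s) over x, y equals χ_g(r ∪ s). Induction, `sum_lrCoeff_mul_ch`: Σ c^g_{x,y}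
χ_g(t) over g equals the sum of χ_x(r) χ_y(s) over all ways of distributing the cycles of t into two
parts r and s. Peeling one partition off the tuple gives a^{n+1}_{l,m} = Σ c^l_{a,x} a^n_{a,a'}
c^m_{a',x}. Applied to the vector χ(t), the right coefficient splits t into r and s, the hypothesis
for n produces n^{|r|}, and the left coefficient glues r and s back to χ_l(t). Summing n^{|r|} over
all splittings gives (n+1)^{|t|} by the binomial theorem: each cycle chooses one of n+1 boxes.

Once χ_l(σ) is known to be the coefficient of s_l in the power sum p_σ, restriction is the identity
p_{r ∪ s} = p_r p_s expanded in Schur functions. Induction follows from restriction and the two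
orthogonality relations, because a splitting t = r + s occurs z_t / (z_r z_s) times.

Most of the work is Frobenius' formula `irrChar_eq_frob` for the trace on the left ideal of a Young
symmetrizer. After multiplication by the Vandermonde alternant, Schur coefficients become
coefficients at the exponents λ + δ, denoted `frob`. The Jacobi-Trudi identity and an orbit count
give the first orthogonality relation for `frob`; inverting a square matrix gives the second. Hence
d! χ_l is a combination of the functions `frob m`, with coefficients `charPairing`. Exchanging a
transposition between row sums and signed column sums shows that this matrix is triangular for the
dominance order, with d! on the diagonal. The same argument shows that its distinct rows are
orthogonal. A triangular matrix with nonzero diagonal and orthogonal rows is diagonal, so χ_l =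
`frob l`. -/

namespace TypeI
open Finset MvPolynomial

/-! ### Alternants and alternating polynomials. -/

/-- The exponent vector of the denominator in the definition of the Schur functions. -/
def stair (N : ℕ) : Fin N → ℕ := fun j => (j.rev : ℕ)

/-- The exponent vector of the numerator in the definition of the Schur functions. -/
def expo (N : ℕ) (l : Ptn) : Fin N → ℕ := fun j => part l j + (j.rev : ℕ)

/-- An exponent vector as a finitely supported function. -/
noncomputable def toFsupp {N : ℕ} (e : Fin N → ℕ) : Fin N →₀ ℕ := Finsupp.equivFunOnFinite.symm e

@[simp] lemma toFsupp_apply {N : ℕ} (e : Fin N → ℕ) (i : Fin N) : toFsupp e i = e i := rfl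

lemma toFsupp_inj {N : ℕ} {e e' : Fin N → ℕ} : toFsupp e = toFsupp e' ↔ e = e' :=
  Finsupp.equivFunOnFinite.symm.injective.eq_iff

lemma toFsupp_coe {N : ℕ} (e : Fin N →₀ ℕ) : toFsupp (⇑e) = e := by
  ext; rfl

lemma prod_X_pow_eq {N : ℕ} (e : Fin N → ℕ) :
    ∏ i, (X i : MvPolynomial (Fin N) ℤ) ^ e i = monomial (toFsupp e) 1 := by
  rw [monomial_eq, Finsupp.prod_fintype _ _ (by simp)]
  simp

lemma alternant_eq_sum (N : ℕ) (e : Fin N → ℕ) :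
    alternant N e = ∑ w : Equiv.Perm (Fin N),
      ((Equiv.Perm.sign w : ℤ)) • (monomial (toFsupp (e ∘ w)) 1 : MvPolynomial (Fin N) ℤ) := by
  rw [alternant, ← Matrix.det_transpose, Matrix.det_apply]
  refine Finset.sum_congr rfl fun w _ => ?_
  rw [← prod_X_pow_eq]
  simp [Units.smul_def]

/-- Such a `w` preserves the order, and a finite chain has no order automorphism but the identity.
-/
lemma eq_one_of_comp_eq {N : ℕ} {e e' : Fin N → ℕ} (he : StrictAnti e) (he' : StrictAnti e')
    {w : Equiv.Perm (Fin N)} (h : e ∘ w = e') : w = 1 := by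
  have hw : StrictMono w := by
    intro i j hij
    have := he' hij
    rw [← h] at this
    exact he.lt_iff_gt.1 this
  have := Subsingleton.elim (hw.orderIsoOfSurjective _ w.surjective) (OrderIso.refl _)
  ext i
  have := congrArg (fun f : Fin N ≃o Fin N => ((f i : Fin N) : ℕ)) this
  simpa using this

/-- In the expansion over permutations only the identity leaves the exponents decreasing.
Coefficients at decreasing exponents therefore act as dual coordinates to the alternants. -/
lemma coeff_alternant_self {N : ℕ} {e e' : Fin N → ℕ} (he : StrictAnti e) (he' : StrictAnti e') :
    coeff (toFsupp e') (alternant N e) = if e = e' then 1 else 0 := by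
  rw [alternant_eq_sum, coeff_sum, Finset.sum_eq_single 1]
  · simp [coeff_monomial, toFsupp_inj]
  · intro w _ hw
    rw [coeff_smul, coeff_monomial, if_neg, smul_zero]
    intro h
    exact hw (eq_one_of_comp_eq he he' (toFsupp_inj.1 h))
  · simp

/-- Polynomials on which a permutation of the variables acts by its sign. -/
def IsAlternating {N : ℕ} (f : MvPolynomial (Fin N) ℤ) : Prop :=
  ∀ w : Equiv.Perm (Fin N), rename w f = (Equiv.Perm.sign w : ℤ) • f

lemma isAlternating_alternant {N : ℕ} (e : Fin N → ℕ) : IsAlternating (alternant N e) := by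
  intro w
  have : rename w (alternant N e) =
      ((Matrix.of fun i j : Fin N => (X i : MvPolynomial (Fin N) ℤ) ^ e j).submatrix w id).det := by
    rw [alternant, AlgHom.map_det]
    congr 1
    ext i j : 2
    simp
  rw [this, Matrix.det_permute, alternant]
  simp

lemma IsAlternating.mul_symm {N : ℕ} {f g : MvPolynomial (Fin N) ℤ} (hf : IsAlternating f)
    (hg : g.IsSymmetric) : IsAlternating (g * f) := by
  intro w
  rw [map_mul, hg, hf w, mul_smul_comm]

lemma IsAlternating.sub {N : ℕ} {f g : MvPolynomial (Fin N) ℤ} (hf : IsAlternating f)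
    (hg : IsAlternating g) : IsAlternating (f - g) := by
  intro w
  rw [map_sub, hf w, hg w, smul_sub]

lemma IsAlternating.sum_smul {N : ℕ} {ι : Type*} (s : Finset ι) (c : ι → ℤ)
    {f : ι → MvPolynomial (Fin N) ℤ} (hf : ∀ i, IsAlternating (f i)) :
    IsAlternating (∑ i ∈ s, c i • f i) := by
  intro w
  rw [map_sum, Finset.smul_sum]
  refine Finset.sum_congr rfl fun i _ => ?_
  rw [map_zsmul, hf i w, smul_comm]

lemma IsAlternating.coeff_comp {N : ℕ} {f : MvPolynomial (Fin N) ℤ} (hf : IsAlternating f)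
    (e : Fin N → ℕ) (w : Equiv.Perm (Fin N)) :
    coeff (toFsupp (e ∘ w)) f = (Equiv.Perm.sign w : ℤ) * coeff (toFsupp e) f := by
  have h := congrArg (coeff (toFsupp e)) (hf w)
  have h2 : toFsupp e = Finsupp.mapDomain w (toFsupp (e ∘ w)) := by
    ext i
    obtain ⟨j, rfl⟩ := w.surjective i
    rw [Finsupp.mapDomain_apply w.injective]
    rfl
  rw [h2, coeff_rename_mapDomain _ w.injective, coeff_smul, ← h2] at h
  rw [h, smul_eq_mul]

lemma exists_comp_antitone {N : ℕ} (e : Fin N → ℕ) :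
    ∃ w : Equiv.Perm (Fin N), Antitone (e ∘ w) := by
  refine ⟨Fin.revPerm.trans (Tuple.sort e), ?_⟩
  have := Tuple.monotone_sort e
  intro i j hij
  exact this (Fin.rev_le_rev.2 hij)

/-- Sorting an exponent changes its coefficient only by a sign. If two entries agree, swapping them
shows that the coefficient is its own negative. So the strictly decreasing exponents decide
everything. -/
lemma IsAlternating.eq_zero {N : ℕ} {f : MvPolynomial (Fin N) ℤ} (hf : IsAlternating f)
    (h : ∀ e : Fin N → ℕ, StrictAnti e → coeff (toFsupp e) f = 0) : f = 0 := by
  ext m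
  rw [coeff_zero, ← toFsupp_coe m]
  obtain ⟨w, hw⟩ := exists_comp_antitone (⇑m)
  by_cases hi : Function.Injective (⇑m)
  · have := hf.coeff_comp m w
    rw [h _ (hw.strictAnti_of_injective (hi.comp w.injective))] at this
    have hs : ((Equiv.Perm.sign w : ℤˣ) : ℤ) ≠ 0 := Units.ne_zero _
    simpa [hs] using this.symm
  · simp only [Function.Injective, not_forall] at hi
    obtain ⟨i, j, hij, hne⟩ := hi
    have := hf.coeff_comp m (Equiv.swap i j)
    have h2 : ⇑m ∘ Equiv.swap i j = ⇑m := by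
      ext k
      by_cases h1 : k = i
      · subst h1; simp [hij]
      · by_cases h2 : k = j
        · subst h2; simp [hij]
        · simp [Equiv.swap_apply_of_ne_of_ne h1 h2]
    rw [h2, Equiv.Perm.sign_swap hne] at this
    simp at this
    linarith

lemma strictAnti_stair (N : ℕ) : StrictAnti (stair N) := by
  intro i j hij
  exact Fin.rev_lt_rev.2 hij

lemma antitone_part (l : Ptn) : Antitone (part l) := by
  intro i j hij
  unfold part
  have hs : (l.2.parts.sort (· ≥ ·)).Pairwise (· ≥ ·) := Multiset.pairwise_sort _ _
  rcases lt_or_ge j (l.2.parts.sort (· ≥ ·)).length with h | h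
  · rw [List.getD_eq_getElem _ _ h, List.getD_eq_getElem _ _ (hij.trans_lt h)]
    rcases hij.eq_or_lt with rfl | hij
    · exact le_rfl
    · exact List.pairwise_iff_getElem.1 hs _ _ _ _ hij
  · rw [List.getD_eq_default _ _ h]; exact Nat.zero_le _

lemma strictAnti_expo (N : ℕ) (l : Ptn) : StrictAnti (expo N l) := fun _ _ hij =>
  add_lt_add_of_le_of_lt (antitone_part l (le_of_lt hij)) (strictAnti_stair N hij)

lemma length_sort_le (l : Ptn) : (l.2.parts.sort (· ≥ ·)).length ≤ l.1 := by
  rw [Multiset.length_sort]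
  have := Multiset.card_nsmul_le_sum (s := l.2.parts) (a := 1)
    (fun x hx => l.2.parts_pos hx)
  rw [l.2.parts_sum] at this
  simpa using this

lemma sum_part_range (l : Ptn) {N : ℕ} (hN : l.1 ≤ N) : ∑ i ∈ range N, part l i = l.1 := by
  have hlen := length_sort_le l
  have h1 : ∑ i ∈ range N, part l i =
      ∑ i ∈ range (l.2.parts.sort (· ≥ ·)).length, part l i := by
    symm
    apply Finset.sum_subset
    · intro x hx
      simp only [Finset.mem_range] at *
      omega
    · intro x _ hx
      simp only [Finset.mem_range, not_lt] at hx
      exact List.getD_eq_default _ _ hx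
  rw [h1]
  unfold part
  have h2 := congrArg Multiset.sum (Multiset.sort_eq l.2.parts (· ≥ ·))
  rw [l.2.parts_sum, Multiset.sum_coe] at h2
  conv_rhs => rw [← h2]
  rw [Finset.sum_range, ← Fin.sum_univ_getElem]
  refine Finset.sum_congr rfl fun i _ => ?_
  exact List.getD_eq_getElem _ _ i.2

lemma sum_expo (l : Ptn) {N : ℕ} (hN : l.1 ≤ N) :
    ∑ i, expo N l i = l.1 + ∑ i, stair N i := by
  unfold expo stair
  rw [Finset.sum_add_distrib, ← Finset.sum_range (fun i => part l i), sum_part_range l hN]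

lemma part_eq_zero (l : Ptn) {i : ℕ} (h : l.1 ≤ i) : part l i = 0 :=
  List.getD_eq_default _ _ ((length_sort_le l).trans h)

lemma eq_of_part_eq {d : ℕ} {l m : Nat.Partition d} (h : ∀ i, part ⟨d, l⟩ i = part ⟨d, m⟩ i) :
    l = m := by
  have key : ∀ l : Nat.Partition d, ∀ i : ℕ, i < (l.parts.sort (· ≥ ·)).length ↔
      0 < part ⟨d, l⟩ i := by
    intro l i
    unfold part
    constructor
    · intro h
      rw [List.getD_eq_getElem _ _ h]
      exact l.parts_pos ((Multiset.mem_sort (· ≥ ·)).1 (List.getElem_mem h))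
    · intro h
      by_contra h2
      rw [List.getD_eq_default _ _ (not_lt.1 h2)] at h
      exact lt_irrefl _ h
  have hlen : (l.parts.sort (· ≥ ·)).length = (m.parts.sort (· ≥ ·)).length := by
    apply eq_of_forall_lt_iff
    intro i
    rw [key, key, h]
  have : l.parts.sort (· ≥ ·) = m.parts.sort (· ≥ ·) := by
    apply List.ext_getElem hlen
    intro i h1 h2
    have := h i
    unfold part at this
    rwa [List.getD_eq_getElem _ _ h1, List.getD_eq_getElem _ _ h2] at this
  apply Nat.Partition.ext
  rw [← Multiset.sort_eq l.parts (· ≥ ·), this, Multiset.sort_eq]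

lemma expo_inj {d N : ℕ} (hN : d ≤ N) {l m : Nat.Partition d} :
    expo N ⟨d, l⟩ = expo N ⟨d, m⟩ ↔ l = m := by
  refine ⟨fun h => eq_of_part_eq fun i => ?_, fun h => by rw [h]⟩
  rcases lt_or_ge i N with hi | hi
  · have := congrFun h ⟨i, hi⟩
    simpa [expo] using this
  · rw [part_eq_zero _ (hN.trans hi), part_eq_zero _ (hN.trans hi)]

/-- Subtracting the staircase from a strictly decreasing vector leaves a weakly decreasing one,
which is a partition padded with zeros. -/
lemma exists_expo_eq {d N : ℕ} (e : Fin N → ℕ) (he : StrictAnti e)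
    (hsum : ∑ i, e i = d + ∑ i, stair N i) : ∃ l : Nat.Partition d, expo N ⟨d, l⟩ = e := by
  -- Induction from the last index upwards: each step to the left raises the entry by at least 1, so
  -- the subtraction below is not truncated.
  have hge : ∀ k : ℕ, ∀ i : Fin N, (i.rev : ℕ) = k → k ≤ e i := by
    intro k
    induction k with
    | zero => simp
    | succ k ih =>
      intro i hi
      have hi' : (i : ℕ) + 1 < N := by
        have := Fin.val_rev i
        omega
      have h1 := ih ⟨i + 1, hi'⟩ (by rw [Fin.val_rev] at *; simp; omega)
      have h2 : e ⟨i + 1, hi'⟩ < e i := he (by rw [Fin.lt_def]; simp)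
      omega
  have hge' : ∀ i, stair N i ≤ e i := fun i => hge _ i rfl
  set p : Fin N → ℕ := fun i => e i - stair N i with hp
  have hpe : ∀ i, p i + stair N i = e i := fun i => Nat.sub_add_cancel (hge' i)
  have hanti1 : ∀ k : ℕ, ∀ i j : Fin N, (j : ℕ) = i + k → p j ≤ p i := by
    intro k
    induction k with
    | zero => intro i j h; rw [show j = i from Fin.ext (by simpa using h)]
    | succ k ih =>
      intro i j h
      have hlt : (i : ℕ) + k < N := by omega
      refine le_trans ?_ (ih i ⟨i + k, hlt⟩ rfl)
      have h1 : e j < e ⟨i + k, hlt⟩ := he (by rw [Fin.lt_def]; simp; omega)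
      have h2 := hpe j
      have h3 := hpe ⟨i + k, hlt⟩
      have h4 : stair N ⟨i + k, hlt⟩ = stair N j + 1 := by
        simp only [stair, Fin.val_rev]; omega
      omega
  have hanti : Antitone p := fun i j hij => hanti1 (j - i) i j (by rw [Fin.le_def] at hij; omega)
  have hps : ∑ i, p i = d := by
    have : ∑ i, p i + ∑ i, stair N i = ∑ i, e i := by
      rw [← Finset.sum_add_distrib]; exact Finset.sum_congr rfl fun i _ => hpe i
    omega
  let M : Multiset ℕ := (List.ofFn p : List ℕ)
  have hM : M.sum = d := by simp [M, List.sum_ofFn, hps]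
  refine ⟨Nat.Partition.ofSums d M hM, ?_⟩
  have hsort : (Nat.Partition.ofSums d M hM).parts.sort (· ≥ ·) = (List.ofFn p).filter (· ≠ 0) := by
    have h1 : (Nat.Partition.ofSums d M hM).parts =
        (((List.ofFn p).filter (· ≠ 0) : List ℕ) : Multiset ℕ) := by
      simp [Nat.Partition.ofSums, M]
    rw [h1]
    refine List.Perm.eq_of_pairwise' (r := (· ≥ ·)) (Multiset.pairwise_sort _ _) ?_ ?_
    · apply List.Pairwise.filter
      rw [List.pairwise_ofFn]
      exact fun _ _ hij => hanti hij.le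
    · rw [← Multiset.coe_eq_coe, Multiset.sort_eq]
  -- `Nat.Partition.ofSums` discards zeros. In a decreasing list they stand at the end, where `getD`
  -- returns its default 0 anyway.
  have hgen : ∀ L : List ℕ, L.Pairwise (· ≥ ·) → ∀ i, (L.filter (· ≠ 0)).getD i 0 = L.getD i 0 := by
    intro L
    induction L with
    | nil => simp
    | cons a L ih =>
      intro h i
      rw [List.pairwise_cons] at h
      by_cases ha : a = 0
      · subst ha
        have hz : ∀ x ∈ L, x = 0 := fun x hx => Nat.le_zero.1 (h.1 x hx)
        have h1 : List.filter (· ≠ 0) (0 :: L) = [] := by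
          rw [List.filter_eq_nil_iff]
          intro x hx
          rcases List.mem_cons.1 hx with rfl | hx
          · simp
          · simp [hz x hx]
        rw [h1]
        rcases lt_or_ge i (0 :: L).length with hi | hi
        · rw [List.getD_eq_getElem _ _ hi]
          rcases List.mem_cons.1 (List.getElem_mem hi) with h | h
          · simp [h]
          · simp [hz _ h]
        · rw [List.getD_eq_default _ _ hi]; simp
      · rw [List.filter_cons_of_pos (by simpa using ha)]
        cases i with
        | zero => simp
        | succ i => simpa using ih h.2 i
  funext i
  have : part ⟨d, Nat.Partition.ofSums d M hM⟩ i = p i := by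
    unfold part
    simp only [hsort]
    rw [hgen _ (by rw [List.pairwise_ofFn]; exact fun _ _ hij => hanti hij.le),
      List.getD_eq_getElem _ _ (by simp)]
    simp
  unfold expo
  rw [this]
  exact hpe i

lemma isHomogeneous_alternant {N : ℕ} (e : Fin N → ℕ) :
    (alternant N e).IsHomogeneous (∑ i, e i) := by
  rw [alternant_eq_sum]
  refine IsHomogeneous.sum _ _ _ fun w _ => ?_
  rw [← prod_X_pow_eq, ← mem_homogeneousSubmodule]
  refine Submodule.smul_of_tower_mem _ _ ?_
  rw [mem_homogeneousSubmodule]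
  have := IsHomogeneous.prod univ (fun i => (X i : MvPolynomial (Fin N) ℤ) ^ (e ∘ w) i)
    (fun i => (e ∘ w) i) (fun i _ => by simpa using (isHomogeneous_X ℤ i).pow ((e ∘ w) i))
  rwa [show ∑ i, (e ∘ w) i = ∑ i, e i from Equiv.sum_comp w e] at this

/-- An alternating polynomial is the combination of alternants given by its coefficients. -/
theorem IsAlternating.eq_sum {d N : ℕ} (hN : d ≤ N) {f : MvPolynomial (Fin N) ℤ}
    (hf : IsAlternating f) (hd : f.IsHomogeneous (d + ∑ i, stair N i)) :
    f = ∑ l : Nat.Partition d, coeff (toFsupp (expo N ⟨d, l⟩)) f • alternant N (expo N ⟨d, l⟩) := by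
  rw [← sub_eq_zero]
  apply (hf.sub (IsAlternating.sum_smul _ _ fun l => isAlternating_alternant _)).eq_zero
  intro e he
  rw [coeff_sub, coeff_sum, sub_eq_zero]
  simp only [coeff_smul, coeff_alternant_self (strictAnti_expo _ _) he]
  by_cases hs : ∑ i, e i = d + ∑ i, stair N i
  · obtain ⟨l, rfl⟩ := exists_expo_eq e he hs
    simp [expo_inj hN]
  · have h1 : coeff (toFsupp e) f = 0 := hd.coeff_eq_zero (by
      rw [Finsupp.degree_eq_sum]; exact hs)
    rw [h1]
    symm
    apply Finset.sum_eq_zero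
    intro l _
    rw [if_neg, smul_zero]
    rintro rfl
    exact hs (sum_expo ⟨d, l⟩ hN)

/-- The alternants of the partitions of `d` are linearly independent. -/
theorem alternant_sum_inj {d N : ℕ} (hN : d ≤ N) {b c : Nat.Partition d → ℤ}
    (h : ∑ l, b l • alternant N (expo N ⟨d, l⟩) = ∑ l, c l • alternant N (expo N ⟨d, l⟩)) :
    b = c := by
  funext l
  have := congrArg (coeff (toFsupp (expo N ⟨d, l⟩))) h
  simp only [coeff_sum, coeff_smul,
    coeff_alternant_self (strictAnti_expo _ _) (strictAnti_expo _ _), expo_inj hN] at this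
  simpa using this

lemma alternant_stair_ne_zero (N : ℕ) : alternant N (stair N) ≠ 0 := by
  intro h
  have := coeff_alternant_self (strictAnti_stair N) (strictAnti_stair N)
  rw [h] at this
  simp at this

end TypeI

namespace TypeI
open Finset MvPolynomial

/-! ### The Jacobi-Trudi identity -/

/-- The complete homogeneous symmetric polynomial, as a sum over exponent vectors. -/
noncomputable def hpoly (N k : ℕ) : MvPolynomial (Fin N) ℤ :=
  ∑ v ∈ piAntidiag (univ : Finset (Fin N)) k, ∏ j, X j ^ v j

/-- The generating function of the h_k is the product of the geometric series 1 / (1 - x_i t). -/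
lemma mk_hpoly (N : ℕ) : PowerSeries.mk (hpoly N) =
    ∏ i : Fin N, PowerSeries.mk fun m => (X i : MvPolynomial (Fin N) ℤ) ^ m := by
  ext1 k
  rw [PowerSeries.coeff_mk, PowerSeries.coeff_prod, hpoly]
  symm
  refine Finset.sum_bij' (fun l _ => ⇑l) (fun v _ => toFsupp v) ?_ ?_ ?_ ?_ ?_
  · intro l hl
    simpa [mem_finsuppAntidiag] using hl
  · intro v hv
    rw [mem_piAntidiag] at hv
    rw [mem_finsuppAntidiag]
    exact ⟨hv.1, fun _ _ => mem_univ _⟩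
  · intro l _; exact toFsupp_coe l
  · intro v _; rfl
  · intro l _; simp

lemma mk_pow_mul_one_sub {R : Type*} [CommRing R] (x : R) :
    (PowerSeries.mk fun m => x ^ m) * (1 - PowerSeries.C x * PowerSeries.X) = 1 := by
  ext k
  rw [mul_sub, mul_one, map_sub, ← mul_assoc, mul_comm _ (PowerSeries.C x), mul_assoc]
  cases k with
  | zero => simp
  | succ k =>
    rw [PowerSeries.coeff_C_mul, PowerSeries.coeff_succ_mul_X]
    simp [pow_succ', PowerSeries.coeff_one]

/-- `∏ (1 - x_k t)` over all variables but `x_l`, as a polynomial in `t`. -/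
noncomputable def omitProd (N : ℕ) (l : Fin N) : Polynomial (MvPolynomial (Fin N) ℤ) :=
  ∏ k ∈ univ.erase l, (1 - Polynomial.C (X k) * Polynomial.X)

lemma natDegree_omitProd (N : ℕ) (l : Fin N) : (omitProd N l).natDegree < N := by
  have hN : 0 < N := l.pos
  refine lt_of_le_of_lt (Polynomial.natDegree_prod_le _ _) ?_
  refine lt_of_le_of_lt (Finset.sum_le_card_nsmul _ _ 1 fun k _ => ?_) ?_
  · compute_degree
  · simp [Finset.card_erase_of_mem, hN]

/-- All geometric series but that of x_l are cancelled. -/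
lemma mk_hpoly_mul_omitProd (N : ℕ) (l : Fin N) :
    PowerSeries.mk (hpoly N) * (omitProd N l : PowerSeries (MvPolynomial (Fin N) ℤ)) =
      PowerSeries.mk fun m => (X l : MvPolynomial (Fin N) ℤ) ^ m := by
  have h1 : (omitProd N l : PowerSeries (MvPolynomial (Fin N) ℤ)) =
      ∏ k ∈ univ.erase l, (1 - PowerSeries.C (X k) * PowerSeries.X) := by
    rw [omitProd, ← Polynomial.coeToPowerSeries.ringHom_apply, map_prod]
    simp
  rw [mk_hpoly, h1, ← Finset.mul_prod_erase univ _ (mem_univ l), mul_assoc,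
    ← Finset.prod_mul_distrib]
  simp [mk_pow_mul_one_sub]

/-- The Jacobi-Trudi matrix of an exponent vector. -/
noncomputable def jacobiTrudi (N : ℕ) (e : Fin N → ℕ) :
    Matrix (Fin N) (Fin N) (MvPolynomial (Fin N) ℤ) :=
  Matrix.of fun i j => if stair N j ≤ e i then hpoly N (e i - stair N j) else 0

/-- Comparing coefficients of t^m writes x_l^m as a sum of products of a factor depending only on m
and one depending only on l. This is the matrix factorisation behind Jacobi-Trudi. -/
lemma X_pow_eq_sum (N : ℕ) (l : Fin N) (m : ℕ) : (X l : MvPolynomial (Fin N) ℤ) ^ m =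
    ∑ j, (if stair N j ≤ m then hpoly N (m - stair N j) else 0) *
      (omitProd N l).coeff (stair N j) := by
  have h := congrArg (PowerSeries.coeff m) (mk_hpoly_mul_omitProd N l)
  rw [PowerSeries.coeff_mk, PowerSeries.coeff_mul, ← Finset.Nat.sum_antidiagonal_swap,
    Finset.Nat.sum_antidiagonal_eq_sum_range_succ_mk] at h
  simp only [Prod.fst_swap, Prod.snd_swap, PowerSeries.coeff_mk, Polynomial.coeff_coe] at h
  rw [← h]
  have h2 : ∑ j : Fin N, (if stair N j ≤ m then hpoly N (m - stair N j) else 0) *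
      (omitProd N l).coeff (stair N j) =
      ∑ j ∈ range N, (if j ≤ m then hpoly N (m - j) else 0) * (omitProd N l).coeff j := by
    rw [Finset.sum_range]
    exact Equiv.sum_comp Fin.revPerm (fun j : Fin N =>
      (if (j : ℕ) ≤ m then hpoly N (m - j) else 0) * (omitProd N l).coeff (j : ℕ))
  rw [h2]
  -- The sum over j < N and the Cauchy product over j ≤ m are compared inside a common range: the
  -- polynomial has degree below N, and terms with j > m are zero by convention.
  have h3 : ∑ j ∈ range N, (if j ≤ m then hpoly N (m - j) else 0) * (omitProd N l).coeff j =
      ∑ j ∈ range (N + m.succ), (if j ≤ m then hpoly N (m - j) else 0) *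
        (omitProd N l).coeff j := by
    apply Finset.sum_subset
    · intro x; simp only [Finset.mem_range]; omega
    · intro x _ hx
      rw [Polynomial.coeff_eq_zero_of_natDegree_lt, mul_zero]
      have := natDegree_omitProd N l
      simp only [Finset.mem_range] at hx
      omega
  rw [h3]
  symm
  rw [← Finset.sum_subset (s₁ := range m.succ)]
  · refine Finset.sum_congr rfl fun j hj => ?_
    rw [if_pos (Nat.lt_succ_iff.1 (Finset.mem_range.1 hj))]
  · intro x; simp only [Finset.mem_range]; omega
  · intro x _ hx
    rw [if_neg, zero_mul]
    simp only [Finset.mem_range] at hx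
    omega

lemma det_jacobiTrudi_stair (N : ℕ) : (jacobiTrudi N (stair N)).det = 1 := by
  rw [Matrix.det_of_isUpperTriangular]
  · apply Finset.prod_eq_one
    intro i _
    simp [jacobiTrudi, hpoly]
  · intro i j hij
    simp only [jacobiTrudi, Matrix.of_apply]
    rw [if_neg]
    exact not_le.2 (strictAnti_stair N hij)

/-- The matrix of powers is, up to transposition, the Jacobi-Trudi matrix of `e` times a matrix `M`
independent of `e`. Taking `e` to be the staircase, where the Jacobi-Trudi matrix is unitriangular,
identifies det M with the Vandermonde alternant. -/
theorem alternant_eq_det_mul (N : ℕ) (e : Fin N → ℕ) :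
    alternant N e = (jacobiTrudi N e).det * alternant N (stair N) := by
  set M : Matrix (Fin N) (Fin N) (MvPolynomial (Fin N) ℤ) :=
    Matrix.of fun j l => (omitProd N l).coeff (stair N j) with hM
  have key : ∀ e, alternant N e = (jacobiTrudi N e).det * M.det := by
    intro e
    rw [← Matrix.det_mul, ← Matrix.det_transpose, alternant]
    congr 1
    ext i j : 2
    rw [Matrix.of_apply, X_pow_eq_sum, Matrix.transpose_apply, Matrix.mul_apply]
    rfl
  rw [key e, key (stair N), det_jacobiTrudi_stair, one_mul]

lemma rename_hpoly (N k : ℕ) (w : Equiv.Perm (Fin N)) : rename w (hpoly N k) = hpoly N k := by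
  have h2 : (PowerSeries.map (rename w : MvPolynomial (Fin N) ℤ →ₐ[ℤ] _).toRingHom)
      (PowerSeries.mk (hpoly N)) = PowerSeries.mk (hpoly N) := by
    rw [mk_hpoly, map_prod]
    have h3 : ∀ i, (PowerSeries.map (rename w : MvPolynomial (Fin N) ℤ →ₐ[ℤ] _).toRingHom)
        (PowerSeries.mk fun m => (X i : MvPolynomial (Fin N) ℤ) ^ m) =
        PowerSeries.mk fun m => (X (w i) : MvPolynomial (Fin N) ℤ) ^ m := by
      intro i
      ext1 m
      simp
    simp_rw [h3]
    exact Equiv.prod_comp w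
      (fun i => PowerSeries.mk fun m => (X i : MvPolynomial (Fin N) ℤ) ^ m)
  have := congrArg (PowerSeries.coeff k) h2
  simpa using this

lemma isSymmetric_det_jacobiTrudi (N : ℕ) (e : Fin N → ℕ) :
    (jacobiTrudi N e).det.IsSymmetric := by
  intro w
  rw [AlgHom.map_det]
  congr 1
  ext i j : 2
  simp only [jacobiTrudi, AlgHom.mapMatrix_apply, Matrix.map_apply, Matrix.of_apply]
  split_ifs
  · rw [rename_hpoly]
  · simp

lemma isHomogeneous_hpoly (N k : ℕ) : (hpoly N k).IsHomogeneous k := by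
  refine IsHomogeneous.sum _ _ _ fun v hv => ?_
  rw [mem_piAntidiag] at hv
  have := IsHomogeneous.prod univ (fun i => (X i : MvPolynomial (Fin N) ℤ) ^ v i)
    (fun i => v i) (fun i _ => by simpa using (isHomogeneous_X ℤ i).pow (v i))
  rwa [hv.1] at this

lemma det_jacobiTrudi_eq_sum (N : ℕ) (e : Fin N → ℕ) : (jacobiTrudi N e).det =
    ∑ w : Equiv.Perm (Fin N), (Equiv.Perm.sign w : ℤ) •
      if ∀ i, stair N (w i) ≤ e i then ∏ i, hpoly N (e i - stair N (w i)) else 0 := by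
  rw [← Matrix.det_transpose, Matrix.det_apply]
  refine Finset.sum_congr rfl fun w _ => ?_
  rw [Units.smul_def]
  congr 1
  simp only [Matrix.transpose_apply, jacobiTrudi, Matrix.of_apply]
  split_ifs with h
  · exact Finset.prod_congr rfl fun i _ => if_pos (h i)
  · push Not at h
    obtain ⟨i, hi⟩ := h
    exact Finset.prod_eq_zero (mem_univ i) (if_neg (not_le.2 hi))

lemma sum_sub_stair {N d : ℕ} {e : Fin N → ℕ} (he : ∑ i, e i = d + ∑ i, stair N i)
    {w : Equiv.Perm (Fin N)} (hw : ∀ i, stair N (w i) ≤ e i) :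
    ∑ i, (e i - stair N (w i)) = d := by
  have h1 : ∑ i, (e i - stair N (w i)) + ∑ i, stair N (w i) = ∑ i, e i := by
    rw [← Finset.sum_add_distrib]
    exact Finset.sum_congr rfl fun i _ => Nat.sub_add_cancel (hw i)
  rw [Equiv.sum_comp w (stair N)] at h1
  omega

lemma isHomogeneous_det_jacobiTrudi {N d : ℕ} {e : Fin N → ℕ}
    (he : ∑ i, e i = d + ∑ i, stair N i) : (jacobiTrudi N e).det.IsHomogeneous d := by
  rw [det_jacobiTrudi_eq_sum]
  refine IsHomogeneous.sum _ _ _ fun w _ => ?_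
  rw [← mem_homogeneousSubmodule]
  refine Submodule.smul_of_tower_mem _ _ ?_
  rw [mem_homogeneousSubmodule]
  split_ifs with h
  · have := IsHomogeneous.prod univ (fun i => hpoly N (e i - stair N (w i)))
      (fun i => e i - stair N (w i)) (fun i _ => isHomogeneous_hpoly _ _)
    rwa [sum_sub_stair he h] at this
  · exact isHomogeneous_zero _ _ _

/-! ### Counting colourings fixed by a permutation -/

section Orbits
variable {d : ℕ} {ι : Type*}

lemma exists_perm_of_content_eq [DecidableEq ι] {f g : Fin d → ι}
    (h : ∀ p, #{i | f i = p} = #{i | g i = p}) : ∃ τ : Equiv.Perm (Fin d), f ∘ τ = g := by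
  have e : ∀ p, {i // g i = p} ≃ {i // f i = p} := fun p => by
    apply Fintype.equivOfCardEq
    rw [Fintype.card_subtype, Fintype.card_subtype, h]
  refine ⟨Equiv.ofFiberEquiv e, ?_⟩
  funext i
  exact Equiv.ofFiberEquiv_map e i

variable [Fintype ι] [DecidableEq ι]

lemma exists_content_eq {m : ι → ℕ} (hm : ∑ p, m p = d) :
    ∃ f : Fin d → ι, ∀ p, #{i | f i = p} = m p := by
  have e : Fin d ≃ (Σ p, Fin (m p)) := by
    apply Fintype.equivOfCardEq
    simp [hm]
  refine ⟨fun i => (e i).1, fun p => ?_⟩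
  have h1 : #{i | (e i).1 = p} = #{x : (Σ p, Fin (m p)) | x.1 = p} := by
    refine Finset.card_bij (fun i _ => e i) ?_ ?_ ?_
    · intro i hi; simpa using hi
    · intro i _ j _ hij; exact e.injective hij
    · intro x hx; exact ⟨e.symm x, by simpa using hx, by simp⟩
  rw [h1, ← Finset.univ_sigma_univ, Finset.card_filter, Finset.sum_sigma]
  simp [apply_ite]

/-- Orbit counting for colourings with prescribed content. -/
lemma sum_card_stabilizer {m : ι → ℕ} (hm : ∑ p, m p = d) :
    ∑ f : Fin d → ι with (∀ p, #{i | f i = p} = m p),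
      #{σ : Equiv.Perm (Fin d) | f ∘ σ = f} = d.factorial := by
  obtain ⟨f₀, hf₀⟩ := exists_content_eq hm
  have h1 : (univ : Finset (Equiv.Perm (Fin d))).card = d.factorial := by
    rw [Finset.card_univ, Fintype.card_perm, Fintype.card_fin]
  -- All d! permutations are sorted by `f₀ ∘ τ`. The fibre over `f = f₀ ∘ τ₀` is the coset of `τ₀`
  -- by the stabilizer of `f`.
  rw [← h1, Finset.card_eq_sum_card_fiberwise (f := fun τ : Equiv.Perm (Fin d) => f₀ ∘ τ)
    (t := {f : Fin d → ι | ∀ p, #{i | f i = p} = m p})]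
  · refine Finset.sum_congr rfl fun f hf => ?_
    rw [Finset.mem_filter_univ] at hf
    obtain ⟨τ₀, rfl⟩ := exists_perm_of_content_eq (f := f₀) (g := f)
      (fun p => by rw [hf₀, hf])
    refine Finset.card_bij (fun σ _ => τ₀ * σ) ?_ ?_ ?_
    · intro σ hσ
      simpa [Function.comp_assoc, Equiv.Perm.coe_mul] using hσ
    · intro σ _ σ' _ h; exact mul_left_cancel h
    · intro τ hτ
      refine ⟨τ₀⁻¹ * τ, ?_, by simp⟩
      simp only [Finset.mem_filter, Finset.mem_univ, true_and] at hτ ⊢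
      rw [Function.comp_assoc, ← Equiv.Perm.coe_mul, mul_inv_cancel_left, hτ]
  · intro τ _
    simp only [Finset.coe_filter, Finset.mem_univ, true_and, Set.mem_ofPred_eq]
    intro p
    rw [← hf₀ p]
    exact Finset.card_bij (fun i _ => τ i) (by simp) (by simp)
      (fun i hi => ⟨τ⁻¹ i, by simpa using hi, by simp⟩)

end Orbits

/-- The power sum polynomial of a permutation: the sum of the monomials of all colourings
of `Fin d` that are constant on its cycles. -/
noncomputable def fixPoly (N : ℕ) {d : ℕ} (σ : Equiv.Perm (Fin d)) : MvPolynomial (Fin N) ℤ :=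
  ∑ f : Fin d → Fin N with f ∘ σ = f, ∏ i, X (f i)

/-- The number of colourings of given content fixed by a permutation. -/
def fixCount {N d : ℕ} (a : Fin N → ℕ) (σ : Equiv.Perm (Fin d)) : ℕ :=
  #{f : Fin d → Fin N | f ∘ σ = f ∧ ∀ p, #{i | f i = p} = a p}

lemma prod_X_comp {N d : ℕ} (f : Fin d → Fin N) :
    ∏ i, (X (f i) : MvPolynomial (Fin N) ℤ) = ∏ p, X p ^ #{i | f i = p} := by
  rw [← Finset.prod_fiberwise univ f]
  refine Finset.prod_congr rfl fun p _ => ?_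
  rw [Finset.prod_congr rfl (g := fun _ => (X p : MvPolynomial (Fin N) ℤ)), Finset.prod_const]
  intro i hi
  rw [(Finset.mem_filter.1 hi).2]

lemma coeff_fixPoly {N d : ℕ} (a : Fin N → ℕ) (σ : Equiv.Perm (Fin d)) :
    coeff (toFsupp a) (fixPoly N σ) = fixCount a σ := by
  rw [fixPoly, coeff_sum, fixCount, ← Finset.filter_filter, Finset.card_filter, Nat.cast_sum]
  refine Finset.sum_congr rfl fun f _ => ?_
  rw [prod_X_comp, prod_X_pow_eq, coeff_monomial]
  simp [toFsupp_inj, funext_iff]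

lemma isSymmetric_fixPoly (N : ℕ) {d : ℕ} (σ : Equiv.Perm (Fin d)) :
    (fixPoly N σ).IsSymmetric := by
  intro w
  rw [fixPoly, map_sum]
  refine Finset.sum_bij' (fun f _ => w ∘ f) (fun f _ => ⇑w⁻¹ ∘ f) ?_ ?_ ?_ ?_ ?_
  · intro f hf
    simp only [Finset.mem_filter_univ] at hf ⊢
    rw [Function.comp_assoc, hf]
  · intro f hf
    simp only [Finset.mem_filter_univ] at hf ⊢
    rw [Function.comp_assoc, hf]
  · intro f _; funext i; simp
  · intro f _; funext i; simp
  · intro f _; simp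

lemma isHomogeneous_fixPoly (N : ℕ) {d : ℕ} (σ : Equiv.Perm (Fin d)) :
    (fixPoly N σ).IsHomogeneous d := by
  refine IsHomogeneous.sum _ _ _ fun f _ => ?_
  simpa using IsHomogeneous.prod univ (fun i => (X (f i) : MvPolynomial (Fin N) ℤ))
    (fun _ => 1) (fun i _ => isHomogeneous_X ℤ (f i))

lemma fixPoly_inv (N : ℕ) {d : ℕ} (σ : Equiv.Perm (Fin d)) : fixPoly N σ⁻¹ = fixPoly N σ := by
  unfold fixPoly
  congr 1
  ext f
  simp only [Finset.mem_filter_univ]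
  constructor
  · intro h; conv_lhs => rw [← h]
    funext i; simp
  · intro h; conv_lhs => rw [← h]
    funext i; simp

/-- A polarised form of the expansion of products of complete homogeneous polynomials in
power sums. -/
lemma sum_fixCount_smul_fixPoly {N d : ℕ} {a : Fin N → ℕ} (ha : ∑ i, a i = d) :
    ∑ σ : Equiv.Perm (Fin d), (fixCount a σ : ℤ) • fixPoly N σ =
      (d.factorial : ℤ) • ∏ i, hpoly N (a i) := by
  -- Two colourings fixed by σ are one colouring by pairs fixed by σ. Summing over σ first then
  -- counts stabilizers.
  have h1 : ∀ σ : Equiv.Perm (Fin d), (fixCount a σ : ℤ) • fixPoly N σ =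
      ∑ F : Fin d → Fin N × Fin N,
        if F ∘ σ = F ∧ (∀ p, #{i | (F i).1 = p} = a p) then
          ∏ i, (X (F i).2 : MvPolynomial (Fin N) ℤ) else 0 := by
    intro σ
    rw [fixPoly, fixCount, natCast_zsmul, ← Finset.sum_const, ← Finset.sum_filter,
      ← Finset.sum_product']
    symm
    refine Finset.sum_bij' (fun F _ => (Prod.fst ∘ F, Prod.snd ∘ F)) (fun p _ i => (p.1 i, p.2 i))
      ?_ ?_ ?_ ?_ ?_
    · intro F hF
      simp only [Finset.mem_filter_univ, Finset.mem_product] at hF ⊢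
      refine ⟨⟨?_, ?_⟩, ?_⟩
      · rw [Function.comp_assoc, hF.1]
      · exact hF.2
      · rw [Function.comp_assoc, hF.1]
    · rintro ⟨f, g⟩ hp
      simp only [Finset.mem_filter_univ, Finset.mem_product] at hp ⊢
      refine ⟨?_, hp.1.2⟩
      funext i
      exact Prod.ext (congrFun hp.1.1 i) (congrFun hp.2 i)
    · intro F _; rfl
    · intro p _; rfl
    · intro F _; rfl
  simp_rw [h1]
  rw [Finset.sum_comm]
  have h2 : ∀ F : Fin d → Fin N × Fin N, (∑ σ : Equiv.Perm (Fin d),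
      if F ∘ σ = F ∧ (∀ p, #{i | (F i).1 = p} = a p) then
          ∏ i, (X (F i).2 : MvPolynomial (Fin N) ℤ) else 0) =
      if (∀ p, #{i | (F i).1 = p} = a p) then
        (#{σ : Equiv.Perm (Fin d) | F ∘ σ = F} : ℤ) •
          ∏ i, (X (F i).2 : MvPolynomial (Fin N) ℤ) else 0 := by
    intro F
    rw [← Finset.sum_filter, Finset.sum_const, natCast_zsmul]
    split_ifs with h
    · congr 2; ext σ; simp [h]
    · rw [Finset.filter_false_of_mem, Finset.card_empty, zero_smul]
      intro σ _ hσ; exact h hσ.2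
  simp_rw [h2]
  rw [← Finset.sum_filter]
  have h3 : ∏ i, hpoly N (a i) = ∑ m ∈ Fintype.piFinset fun i => piAntidiag univ (a i),
      ∏ i, ∏ j, (X j : MvPolynomial (Fin N) ℤ) ^ m i j := by
    simp only [hpoly]
    rw [Finset.prod_univ_sum]
  -- Pair colourings are grouped by the matrix `m` counting each pair. Its row sums are `a`, it
  -- determines the monomial, and orbit counting gives each matrix the weight d!.
  rw [h3, ← Finset.sum_fiberwise_of_maps_to
    (t := Fintype.piFinset fun i => piAntidiag (univ : Finset (Fin N)) (a i))
    (g := fun (F : Fin d → Fin N × Fin N) i j => #{k | F k = (i, j)}), Finset.smul_sum]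
  · refine Finset.sum_congr rfl fun m hm => ?_
    simp only [Fintype.mem_piFinset, mem_piAntidiag] at hm
    have hm' : ∑ p : Fin N × Fin N, m p.1 p.2 = d := by
      rw [Fintype.sum_prod_type, ← ha]
      exact Finset.sum_congr rfl fun i _ => (hm i).1
    have h4 := sum_card_stabilizer (ι := Fin N × Fin N) (m := fun p => m p.1 p.2) hm'
    rw [← h4, Nat.cast_sum, Finset.sum_smul, Finset.filter_filter]
    have h5 : ({F : Fin d → Fin N × Fin N | (∀ p, #{i | (F i).1 = p} = a p) ∧
        (fun i j => #{k | F k = (i, j)}) = m} : Finset (Fin d → Fin N × Fin N)) =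
        ({F : Fin d → Fin N × Fin N | ∀ p : Fin N × Fin N, #{i | F i = p} = m p.1 p.2} :
          Finset (Fin d → Fin N × Fin N)) := by
      ext F
      simp only [Finset.mem_filter_univ]
      constructor
      · rintro ⟨_, rfl⟩ p; rfl
      · intro h
        have h' : (fun i j => #{k | F k = (i, j)}) = m := by
          funext i j; exact h (i, j)
        refine ⟨fun p => ?_, h'⟩
        rw [← (hm p).1, Finset.card_eq_sum_card_fiberwise (f := fun k => (F k).2) (t := univ)
          (by simp)]
        refine Finset.sum_congr rfl fun j _ => ?_
        rw [← h', Finset.filter_filter]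
        simp only [Prod.ext_iff]
    rw [h5]
    refine Finset.sum_congr rfl fun F hF => ?_
    rw [Finset.mem_filter_univ] at hF
    congr 1
    rw [← Finset.prod_fiberwise univ F]
    rw [Fintype.prod_prod_type]
    refine Finset.prod_congr rfl fun i _ => Finset.prod_congr rfl fun j _ => ?_
    rw [Finset.prod_congr rfl (g := fun _ => (X j : MvPolynomial (Fin N) ℤ)), Finset.prod_const,
      hF]
    intro k hk
    rw [(Finset.mem_filter.1 hk).2]
  · intro F hF
    simp only [Finset.mem_filter_univ, Fintype.mem_piFinset, mem_piAntidiag] at hF ⊢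
    intro i
    refine ⟨?_, by simp⟩
    rw [← hF i, Finset.card_eq_sum_card_fiberwise (f := fun k => (F k).2) (t := univ) (by simp)]
    refine Finset.sum_congr rfl fun j _ => ?_
    rw [Finset.filter_filter]
    simp only [Prod.ext_iff]

/-! ### Coefficients of power sums in alternants -/

/-- The coefficient of the Schur polynomial `s_l` in the power sum polynomial of `σ`. -/
noncomputable def frob (N : ℕ) {d : ℕ} (l : Nat.Partition d) (σ : Equiv.Perm (Fin d)) : ℤ :=
  coeff (toFsupp (expo N ⟨d, l⟩)) (fixPoly N σ * alternant N (stair N))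

/-- A symmetric polynomial times the Vandermonde alternant is alternating, so it is a combination of
alternants. -/
theorem fixPoly_mul_alternant {N d : ℕ} (hN : d ≤ N) (σ : Equiv.Perm (Fin d)) :
    fixPoly N σ * alternant N (stair N) =
      ∑ l : Nat.Partition d, frob N l σ • alternant N (expo N ⟨d, l⟩) :=
  ((isAlternating_alternant _).mul_symm (isSymmetric_fixPoly N σ)).eq_sum hN
    ((isHomogeneous_fixPoly N σ).mul (isHomogeneous_alternant _))

lemma frob_inv (N : ℕ) {d : ℕ} (l : Nat.Partition d) (σ : Equiv.Perm (Fin d)) :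
    frob N l σ⁻¹ = frob N l σ := by
  rw [frob, fixPoly_inv, frob]

/-- Expanding the Vandermonde alternant exhibits `frob` as an alternating sum of permutation
characters of contents λ + δ - wδ; terms with a negative entry drop out. -/
lemma frob_eq_sum (N : ℕ) {d : ℕ} (l : Nat.Partition d) (σ : Equiv.Perm (Fin d)) :
    frob N l σ = ∑ w : Equiv.Perm (Fin N), (Equiv.Perm.sign w : ℤ) *
      if ∀ i, stair N (w i) ≤ expo N ⟨d, l⟩ i then
        (fixCount (fun i => expo N ⟨d, l⟩ i - stair N (w i)) σ : ℤ) else 0 := by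
  rw [frob, alternant_eq_sum, Finset.mul_sum, coeff_sum]
  refine Finset.sum_congr rfl fun w _ => ?_
  rw [mul_smul_comm, coeff_smul, coeff_mul_monomial', smul_eq_mul]
  congr 1
  have : toFsupp (stair N ∘ w) ≤ toFsupp (expo N ⟨d, l⟩) ↔
      ∀ i, stair N (w i) ≤ expo N ⟨d, l⟩ i := Iff.rfl
  simp only [this, mul_one]
  split_ifs
  · rw [← coeff_fixPoly]
    congr 1
    ext i
    rfl
  · rfl

/-- The alternating sum for `frob` and the expansion of the Jacobi-Trudi determinant agree term by
term, each permutation character being sent to d! times a product of h's. -/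
theorem sum_frob_smul_fixPoly {N d : ℕ} (hN : d ≤ N) (l : Nat.Partition d) :
    ∑ σ : Equiv.Perm (Fin d), frob N l σ • fixPoly N σ =
      (d.factorial : ℤ) • (jacobiTrudi N (expo N ⟨d, l⟩)).det := by
  simp_rw [frob_eq_sum, Finset.sum_smul]
  rw [Finset.sum_comm, det_jacobiTrudi_eq_sum, Finset.smul_sum]
  refine Finset.sum_congr rfl fun w _ => ?_
  simp_rw [mul_smul]
  rw [← Finset.smul_sum, smul_comm]
  congr 1
  split_ifs with h
  · exact sum_fixCount_smul_fixPoly (sum_sub_stair (sum_expo ⟨d, l⟩ hN) h)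
  · simp

/-- The first orthogonality relation. -/
theorem sum_frob_mul_frob {N d : ℕ} (hN : d ≤ N) (l m : Nat.Partition d) :
    ∑ σ : Equiv.Perm (Fin d), frob N l σ * frob N m σ =
      if l = m then (d.factorial : ℤ) else 0 := by
  -- Multiplication by the Vandermonde alternant turns both sides into combinations of alternants,
  -- whose coefficients can be compared.
  have h := congrArg (· * alternant N (stair N)) (sum_frob_smul_fixPoly hN l)
  simp only [smul_mul_assoc, ← alternant_eq_det_mul, Finset.sum_mul,
    fixPoly_mul_alternant hN, Finset.smul_sum, smul_smul] at h
  rw [Finset.sum_comm] at h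
  simp_rw [← Finset.sum_smul] at h
  have h2 : (d.factorial : ℤ) • alternant N (expo N ⟨d, l⟩) =
      ∑ m : Nat.Partition d, (if l = m then (d.factorial : ℤ) else 0) •
        alternant N (expo N ⟨d, m⟩) := by
    simp [ite_smul]
  rw [h2] at h
  exact congrFun (alternant_sum_inj hN h) m

end TypeI

namespace TypeI
open Finset

/-! ### Combinatorics of the standard tableau -/

section Tableau
variable {d : ℕ} (l : Nat.Partition d)

lemma blocksFun_eq_part (i : Fin (rowComposition l).length) :
    (rowComposition l).blocksFun i = part ⟨d, l⟩ i := by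
  exact (List.getD_eq_getElem (l.parts.sort (· ≥ ·)) 0 i.2).symm

lemma col_lt_part (i : Fin d) : col l i < part ⟨d, l⟩ (row l i) := by
  exact ((rowComposition l).invEmbedding i).2.trans_eq (blocksFun_eq_part l _)

lemma exists_row_col {r c : ℕ} (h : c < part ⟨d, l⟩ r) : ∃ i, row l i = r ∧ col l i = c := by
  have hr : r < (rowComposition l).length := by
    by_contra hr
    have h0 : part ⟨d, l⟩ r = 0 := List.getD_eq_default _ _ (not_lt.1 hr)
    omega
  have hc : c < (rowComposition l).blocksFun ⟨r, hr⟩ := by rwa [blocksFun_eq_part]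
  refine ⟨(rowComposition l).embedding ⟨r, hr⟩ ⟨c, hc⟩, ?_, ?_⟩
  · rw [row, Composition.index_embedding]
  · rw [col, Composition.invEmbedding_comp]

lemma row_col_inj {i j : Fin d} (hr : row l i = row l j) (hc : col l i = col l j) : i = j := by
  apply (rowComposition l).blocksFinEquiv.symm.injective
  have hr' : (rowComposition l).index i = (rowComposition l).index j := Fin.ext hr
  apply Sigma.ext hr'
  rw [Fin.heq_ext_iff]
  · exact hc
  · change (rowComposition l).blocksFun ((rowComposition l).index i) =
      (rowComposition l).blocksFun ((rowComposition l).index j)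
    rw [hr']

lemma card_row_eq (r : ℕ) : #{i | row l i = r} = part ⟨d, l⟩ r := by
  rw [← Finset.card_range (part ⟨d, l⟩ r)]
  refine Finset.card_bij (fun i _ => col l i) ?_ ?_ ?_
  · intro i hi
    rw [Finset.mem_filter_univ] at hi
    rw [Finset.mem_range, ← hi]
    exact col_lt_part l i
  · intro i hi j hj h
    rw [Finset.mem_filter_univ] at hi hj
    exact row_col_inj l (hi.trans hj.symm) h
  · intro c hc
    obtain ⟨i, hi, hc⟩ := exists_row_col l (Finset.mem_range.1 hc)
    exact ⟨i, by simpa using hi, hc⟩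

variable {l} {f κ : Fin d → ℕ}

/-- Within one class of `κ` the values of `f` are distinct, so at most k of them are below k. Either
column j of `l` reaches below its first k rows and attains this bound, or it lies entirely within
them and contains the whole count. -/
lemma card_lt_and_eq_le (hinj : ∀ x y, f x = f y → κ x = κ y → x = y)
    (hκ : ∀ j, #{i | κ i = j} = #{i | col l i = j}) (k j : ℕ) :
    #{i | f i < k ∧ κ i = j} ≤ #{i | row l i < k ∧ col l i = j} := by
  by_cases h : ∃ y, col l y = j ∧ k ≤ row l y
  · obtain ⟨y, hy, hk⟩ := h
    calc #{i | f i < k ∧ κ i = j} ≤ #(range k) := by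
          refine Finset.card_le_card_of_injOn f ?_ ?_
          · intro i hi
            simp only [Finset.coe_filter, Finset.mem_univ, true_and, Set.mem_ofPred_eq] at hi
            simpa using hi.1
          · intro x hx y hy hxy
            simp only [Finset.coe_filter, Finset.mem_univ, true_and, Set.mem_ofPred_eq] at hx hy
            exact hinj x y hxy (hx.2.trans hy.2.symm)
      _ ≤ _ := by
          have hex : ∀ r ∈ range k, ∃ i, row l i = r ∧ col l i = j := fun r hr => by
            apply exists_row_col
            rw [Finset.mem_range] at hr
            have h1 := col_lt_part l y
            have h2 := antitone_part ⟨d, l⟩ (show r ≤ row l y by omega)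
            omega
          have : Nonempty (Fin d) := ⟨y⟩
          choose! g hg using hex
          refine Finset.card_le_card_of_injOn g ?_ ?_
          · intro r hr
            have := hg r hr
            simp only [Finset.coe_filter, Finset.mem_univ, true_and, Set.mem_ofPred_eq]
            rw [this.1]
            exact ⟨by simpa using hr, this.2⟩
          · intro r hr s hs hrs
            rw [← (hg r hr).1, ← (hg s hs).1, hrs]
  · push Not at h
    calc #{i | f i < k ∧ κ i = j} ≤ #{i | κ i = j} :=
          Finset.card_le_card (Finset.monotone_filter_right _ fun _ _ h => h.2)
      _ = #{i | col l i = j} := hκ j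
      _ ≤ _ := Finset.card_le_card (Finset.monotone_filter_right _ fun i _ hi => ⟨h i hi, hi⟩)

lemma card_filter_eq_sum_and (P : Fin d → Prop) [DecidablePred P] (g : Fin d → ℕ) (t : Finset ℕ)
    (ht : ∀ i, g i ∈ t) : #{i | P i} = ∑ j ∈ t, #{i | P i ∧ g i = j} := by
  rw [Finset.card_eq_sum_card_fiberwise (f := g) (t := t) (fun i _ => ht i)]
  refine Finset.sum_congr rfl fun j _ => ?_
  rw [Finset.filter_filter]

/-- Summing over columns: a filling of the columns of `l` without repetition in any column has
content dominated by `l`. -/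
lemma card_lt_le (hinj : ∀ x y, f x = f y → κ x = κ y → x = y)
    (hκ : ∀ j, #{i | κ i = j} = #{i | col l i = j}) (k : ℕ) :
    #{i | f i < k} ≤ #{i | row l i < k} := by
  rw [card_filter_eq_sum_and _ κ (univ.image κ ∪ univ.image (col l)) (by simp),
    card_filter_eq_sum_and _ (col l) (univ.image κ ∪ univ.image (col l)) (by simp)]
  exact Finset.sum_le_sum fun j _ => card_lt_and_eq_le hinj hκ k j

lemma card_lt_succ_and (g h : Fin d → ℕ) (k j : ℕ) :
    #{i | g i < k + 1 ∧ h i = j} = #{i | g i < k ∧ h i = j} + #{i | g i = k ∧ h i = j} := by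
  rw [← Finset.card_union_of_disjoint]
  · congr 1
    ext i
    simp only [Finset.mem_filter_univ, Finset.mem_union, Nat.lt_succ_iff_lt_or_eq]
    tauto
  · rw [Finset.disjoint_filter]
    rintro i _ ⟨h1, _⟩ ⟨h2, _⟩
    omega

/-- When `f` is `row l` itself, the column inequalities have equal totals and are therefore
equalities. Rows and `κ`-classes then meet as rows and columns do, so `κ` is obtained from `col l`
by permuting within rows. -/
lemma exists_perm_row_col (hinj : ∀ x y, row l x = row l y → κ x = κ y → x = y)
    (hκ : ∀ j, #{i | κ i = j} = #{i | col l i = j}) :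
    ∃ z : Equiv.Perm (Fin d), (∀ i, row l (z i) = row l i) ∧ ∀ i, col l (z i) = κ i := by
  have h1 : ∀ k j, #{i | row l i < k ∧ κ i = j} = #{i | row l i < k ∧ col l i = j} := by
    intro k j
    set t := insert j (univ.image κ ∪ univ.image (col l)) with ht
    have h2 := card_filter_eq_sum_and (fun i => row l i < k) κ t (by simp [ht])
    rw [card_filter_eq_sum_and (fun i => row l i < k) (col l) t (by simp [ht])] at h2
    exact ((Finset.sum_eq_sum_iff_of_le fun j _ => card_lt_and_eq_le hinj hκ k j).1 h2.symm j
      (by simp [ht]))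
  -- Subtracting the counts for consecutive k isolates a single row.
  have h3 : ∀ i, ∃ z, row l z = row l i ∧ col l z = κ i := by
    intro i
    have h4 := h1 (row l i + 1) (κ i)
    rw [card_lt_succ_and, card_lt_succ_and, h1, add_right_inj] at h4
    have h5 : 0 < #{x | row l x = row l i ∧ κ x = κ i} :=
      Finset.card_pos.2 ⟨i, by simp⟩
    rw [h4] at h5
    obtain ⟨z, hz⟩ := Finset.card_pos.1 h5
    exact ⟨z, by simpa using hz⟩
  choose z hz using h3
  have hzi : Function.Injective z := by
    intro x y hxy
    apply hinj
    · rw [← (hz x).1, ← (hz y).1, hxy]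
    · rw [← (hz x).2, ← (hz y).2, hxy]
  exact ⟨Equiv.ofBijective z (Finite.injective_iff_bijective.1 hzi), fun i => (hz i).1,
    fun i => (hz i).2⟩

lemma card_comp_perm_eq (h : Fin d → ℕ) (g : Equiv.Perm (Fin d)) (j : ℕ) :
    #{i | h (g i) = j} = #{i | h i = j} :=
  Finset.card_bij (fun i _ => g i) (by simp) (by simp)
    (fun i hi => ⟨g⁻¹ i, by simpa using hi, by simp⟩)

end Tableau
end TypeI

namespace TypeI
open Finset

/-! ### Young symmetrizers -/

section Symmetrizers
variable (F : Type*) [Field F] {d : ℕ}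

/-- The sum of the permutations that preserve a colouring. -/
noncomputable def stabSum {ι : Type*} [DecidableEq ι] (f : Fin d → ι) :
    MonoidAlgebra F (Equiv.Perm (Fin d)) :=
  ∑ p : Equiv.Perm (Fin d) with ∀ i, f (p i) = f i, MonoidAlgebra.single p 1

/-- The signed sum of the permutations that preserve a colouring. -/
noncomputable def signSum {ι : Type*} [DecidableEq ι] (f : Fin d → ι) :
    MonoidAlgebra F (Equiv.Perm (Fin d)) :=
  ∑ q : Equiv.Perm (Fin d) with ∀ i, f (q i) = f i,
    MonoidAlgebra.single q (((Equiv.Perm.sign q : ℤ) : F))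

lemma single_eq_smul (g : Equiv.Perm (Fin d)) (a : F) :
    MonoidAlgebra.single g a = a • MonoidAlgebra.single g 1 := by
  rw [MonoidAlgebra.smul_single, smul_eq_mul, mul_one]

lemma youngSymmetrizer_eq (l : Nat.Partition d) :
    youngSymmetrizer F l = stabSum F (row l) * signSum F (col l) := rfl

section
variable {d : ℕ} {ι : Type*} {f : Fin d → ι}

lemma inv_mem_stab {p : Equiv.Perm (Fin d)} (hp : ∀ i, f (p i) = f i) (i : Fin d) :
    f (p⁻¹ i) = f i := by
  rw [← hp (p⁻¹ i)]; simp

lemma swap_mem_stab {x y : Fin d} (h : f x = f y) (i : Fin d) : f (Equiv.swap x y i) = f i := by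
  by_cases h1 : i = x
  · subst h1; simp [h]
  · by_cases h2 : i = y
    · subst h2; simp [h]
    · rw [Equiv.swap_apply_of_ne_of_ne h1 h2]

end

variable {ι : Type*} [DecidableEq ι] {f : Fin d → ι}

lemma stabSum_mul_single {p : Equiv.Perm (Fin d)} (hp : ∀ i, f (p i) = f i) :
    stabSum F f * MonoidAlgebra.single p 1 = stabSum F f := by
  unfold stabSum
  rw [Finset.sum_mul]
  refine Finset.sum_equiv (Equiv.mulRight p) ?_ ?_
  · intro q
    simp only [Finset.mem_filter_univ, Equiv.coe_mulRight, Equiv.Perm.mul_apply]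
    constructor
    · intro h i; rw [h, hp]
    · intro h i
      have := h (p⁻¹ i)
      rw [inv_mem_stab hp] at this
      simpa using this
  · intro q _
    simp [MonoidAlgebra.single_mul_single]

lemma single_mul_stabSum {p : Equiv.Perm (Fin d)} (hp : ∀ i, f (p i) = f i) :
    MonoidAlgebra.single p 1 * stabSum F f = stabSum F f := by
  unfold stabSum
  rw [Finset.mul_sum]
  refine Finset.sum_equiv (Equiv.mulLeft p) ?_ ?_
  · intro q
    simp only [Finset.mem_filter_univ, Equiv.coe_mulLeft, Equiv.Perm.mul_apply, hp]
  · intro q _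
    simp [MonoidAlgebra.single_mul_single]

lemma single_mul_signSum {p : Equiv.Perm (Fin d)} (hp : ∀ i, f (p i) = f i) :
    MonoidAlgebra.single p 1 * signSum F f = ((Equiv.Perm.sign p : ℤ) : F) • signSum F f := by
  unfold signSum
  rw [Finset.mul_sum, Finset.smul_sum]
  refine Finset.sum_equiv (Equiv.mulLeft p) ?_ ?_
  · intro q
    simp only [Finset.mem_filter_univ, Equiv.coe_mulLeft, Equiv.Perm.mul_apply, hp]
  · intro q _
    rw [MonoidAlgebra.single_mul_single, MonoidAlgebra.smul_single]
    congr 1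
    rcases Int.units_eq_one_or (Equiv.Perm.sign p) with h | h <;> simp [h]

lemma signSum_mul_single {p : Equiv.Perm (Fin d)} (hp : ∀ i, f (p i) = f i) :
    signSum F f * MonoidAlgebra.single p 1 = ((Equiv.Perm.sign p : ℤ) : F) • signSum F f := by
  unfold signSum
  rw [Finset.sum_mul, Finset.smul_sum]
  refine Finset.sum_equiv (Equiv.mulRight p) ?_ ?_
  · intro q
    simp only [Finset.mem_filter_univ, Equiv.coe_mulRight, Equiv.Perm.mul_apply]
    constructor
    · intro h i; rw [h, hp]
    · intro h i
      have := h (p⁻¹ i)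
      rw [inv_mem_stab hp] at this
      simpa using this
  · intro q _
    rw [MonoidAlgebra.single_mul_single, MonoidAlgebra.smul_single]
    congr 1
    rcases Int.units_eq_one_or (Equiv.Perm.sign p) with h | h <;> simp [h]

lemma stabSum_mul_stabSum (f : Fin d → ι) : stabSum F f * stabSum F f =
    (#{p : Equiv.Perm (Fin d) | ∀ i, f (p i) = f i} : F) • stabSum F f := by
  conv_lhs => enter [2]; unfold stabSum
  rw [Finset.mul_sum, Finset.sum_congr rfl (g := fun _ => stabSum F f)]
  · rw [Finset.sum_const, Nat.cast_smul_eq_nsmul]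
  · intro p hp
    exact stabSum_mul_single F (by simpa using hp)

variable [CharZero F]

lemma eq_zero_of_eq_neg {A : Type*} [AddCommGroup A] [Module F A] {v : A} (h : v = -v) : v = 0 := by
  have h2 : (2 : F) • v = 0 := by
    rw [two_smul]; nth_rw 1 [h]; simp
  exact (smul_eq_zero.1 h2).resolve_left two_ne_zero

/-- The transposition of `x` and `y` is absorbed by the row sum; moved past `g` it becomes one
absorbed by the column sum with sign -1. The product is thus its own negative. -/
lemma stabSum_mul_single_mul_signSum_eq_zero {κ : Fin d → ℕ} {g : Equiv.Perm (Fin d)}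
    {x y : Fin d} (hxy : x ≠ y) (hf : f x = f y) (hκ : κ (g⁻¹ x) = κ (g⁻¹ y)) :
    stabSum F f * MonoidAlgebra.single g 1 * signSum F κ = 0 := by
  apply eq_zero_of_eq_neg F
  have h1 := stabSum_mul_single F (swap_mem_stab hf)
  have h2 := single_mul_signSum F (swap_mem_stab hκ)
  have h3 : Equiv.swap x y * g = g * Equiv.swap (g⁻¹ x) (g⁻¹ y) := by
    rw [Equiv.mul_swap_eq_swap_mul]; simp
  have h4 : MonoidAlgebra.single (Equiv.swap x y) (1 : F) * MonoidAlgebra.single g 1 =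
      MonoidAlgebra.single g 1 * MonoidAlgebra.single (Equiv.swap (g⁻¹ x) (g⁻¹ y)) 1 := by
    rw [MonoidAlgebra.single_mul_single, MonoidAlgebra.single_mul_single, h3]
  have hne : g⁻¹ x ≠ g⁻¹ y := fun h => hxy (g⁻¹.injective h)
  conv_lhs => rw [← h1]
  rw [mul_assoc (stabSum F f), h4, mul_assoc, mul_assoc, h2, Equiv.Perm.sign_swap hne]
  simp [mul_assoc]

lemma signSum_mul_single_mul_stabSum_eq_zero {κ : Fin d → ℕ} {g : Equiv.Perm (Fin d)}
    {x y : Fin d} (hxy : x ≠ y) (hf : f x = f y) (hκ : κ (g x) = κ (g y)) :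
    signSum F κ * MonoidAlgebra.single g 1 * stabSum F f = 0 := by
  apply eq_zero_of_eq_neg F
  have h1 := single_mul_stabSum F (swap_mem_stab hf)
  have h2 := signSum_mul_single F (swap_mem_stab hκ)
  have h3 : Equiv.swap (g x) (g y) * g = g * Equiv.swap x y := by
    rw [Equiv.mul_swap_eq_swap_mul]
  have h4 : MonoidAlgebra.single g (1 : F) * MonoidAlgebra.single (Equiv.swap x y) 1 =
      MonoidAlgebra.single (Equiv.swap (g x) (g y)) 1 * MonoidAlgebra.single g 1 := by
    rw [MonoidAlgebra.single_mul_single, MonoidAlgebra.single_mul_single, h3]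
  have hne : g x ≠ g y := fun h => hxy (g.injective h)
  conv_lhs => rw [← h1]
  rw [mul_assoc, ← mul_assoc (MonoidAlgebra.single g 1), h4, mul_assoc, ← mul_assoc, h2,
    Equiv.Perm.sign_swap hne]
  simp [mul_assoc]

end Symmetrizers

/-! ### Products of row sums and signed column sums, and dominance. -/

section Dominance
variable (F : Type*) [Field F] [CharZero F] {d : ℕ}

/-- The partial sums of the content of a colouring are bounded by those of a partition. -/
def Dominated (f : Fin d → ℕ) (l : Nat.Partition d) : Prop :=
  ∀ k, #{i | f i < k} ≤ #{i | row l i < k}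

/-- For each `g` two points share an `f`-class and a translated column, and the exchange argument
applies; otherwise `card_lt_le` would give dominance. -/
lemma stabSum_mul_signSum_eq_zero {f : Fin d → ℕ} {l : Nat.Partition d} (h : ¬ Dominated f l)
    (x : MonoidAlgebra F (Equiv.Perm (Fin d))) : stabSum F f * x * signSum F (col l) = 0 := by
  induction x using MonoidAlgebra.induction_linear with
  | zero => simp
  | add x y hx hy => rw [mul_add, add_mul, hx, hy, add_zero]
  | single g a =>
    by_cases hex : ∃ x y, x ≠ y ∧ f x = f y ∧ col l (g⁻¹ x) = col l (g⁻¹ y)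
    · obtain ⟨x, y, hxy, hf, hκ⟩ := hex
      have := stabSum_mul_single_mul_signSum_eq_zero F hxy hf hκ
      rw [single_eq_smul, mul_smul_comm,
        smul_mul_assoc, this, smul_zero]
    · push Not at hex
      exact (h fun k => card_lt_le (l := l) (κ := fun i => col l (g⁻¹ i))
        (fun x y h1 h2 => by_contra fun h3 => hex x y h3 h1 h2)
        (card_comp_perm_eq _ _) k).elim

lemma signSum_mul_stabSum_eq_zero {f : Fin d → ℕ} {l : Nat.Partition d} (h : ¬ Dominated f l)
    (x : MonoidAlgebra F (Equiv.Perm (Fin d))) : signSum F (col l) * x * stabSum F f = 0 := by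
  induction x using MonoidAlgebra.induction_linear with
  | zero => simp
  | add x y hx hy => rw [mul_add, add_mul, hx, hy, add_zero]
  | single g a =>
    by_cases hex : ∃ x y, x ≠ y ∧ f x = f y ∧ col l (g x) = col l (g y)
    · obtain ⟨x, y, hxy, hf, hκ⟩ := hex
      have := signSum_mul_single_mul_stabSum_eq_zero F hxy hf hκ
      rw [single_eq_smul, mul_smul_comm,
        smul_mul_assoc, this, smul_zero]
    · push Not at hex
      exact (h fun k => card_lt_le (l := l) (κ := fun i => col l (g i))
        (fun x y h1 h2 => by_contra fun h3 => hex x y h3 h1 h2)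
        (card_comp_perm_eq _ _) k).elim

/-- Von Neumann's argument: either the exchange argument kills the term of `g`, or `g` is a row
permutation times a column permutation, both absorbed up to sign. -/
lemma exists_stabSum_mul_signSum_eq_smul (l : Nat.Partition d)
    (x : MonoidAlgebra F (Equiv.Perm (Fin d))) :
    ∃ s : F, stabSum F (row l) * x * signSum F (col l) = s • youngSymmetrizer F l := by
  induction x using MonoidAlgebra.induction_linear with
  | zero => exact ⟨0, by simp⟩
  | add x y hx hy =>
    obtain ⟨s, hs⟩ := hx
    obtain ⟨t, ht⟩ := hy
    exact ⟨s + t, by rw [mul_add, add_mul, hs, ht, add_smul]⟩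
  | single g a =>
    rw [single_eq_smul]
    by_cases hex : ∃ x y, x ≠ y ∧ row l x = row l y ∧ col l (g⁻¹ x) = col l (g⁻¹ y)
    · obtain ⟨x, y, hxy, hf, hκ⟩ := hex
      refine ⟨0, ?_⟩
      rw [mul_smul_comm, smul_mul_assoc,
        stabSum_mul_single_mul_signSum_eq_zero F hxy hf hκ, smul_zero, zero_smul]
    · push Not at hex
      obtain ⟨z, hz1, hz2⟩ := exists_perm_row_col (l := l) (κ := fun i => col l (g⁻¹ i))
        (fun x y h1 h2 => by_contra fun h3 => hex x y h3 h1 h2) (card_comp_perm_eq _ _)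
      have hq : ∀ i, col l ((z * g) i) = col l i := by
        intro i
        rw [Equiv.Perm.mul_apply, hz2]; simp
      have hg : MonoidAlgebra.single g (1 : F) =
          MonoidAlgebra.single z⁻¹ 1 * MonoidAlgebra.single (z * g) 1 := by
        rw [MonoidAlgebra.single_mul_single]; simp
      refine ⟨a * ((Equiv.Perm.sign (z * g) : ℤ) : F), ?_⟩
      rw [mul_smul_comm, smul_mul_assoc, hg, ← mul_assoc,
        stabSum_mul_single F (inv_mem_stab hz1), mul_assoc, single_mul_signSum F hq,
        mul_smul_comm, smul_smul, youngSymmetrizer_eq]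

end Dominance

/-! ### Irreducible characters as traces on the group algebra. -/

section Characters
variable (F : Type*) [Field F] {d : ℕ}

/-- The trace of `x ↦ u x v` on the group algebra. -/
noncomputable def trMul (u v : MonoidAlgebra F (Equiv.Perm (Fin d))) : F :=
  LinearMap.trace F (MonoidAlgebra F (Equiv.Perm (Fin d)))
    (LinearMap.mulLeft F u ∘ₗ LinearMap.mulRight F v)

lemma trMul_add_left (u u' v : MonoidAlgebra F (Equiv.Perm (Fin d))) :
    trMul F (u + u') v = trMul F u v + trMul F u' v := by
  unfold trMul
  rw [← map_add]
  congr 1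
  ext; simp [add_mul]

lemma trMul_smul_left (s : F) (u v : MonoidAlgebra F (Equiv.Perm (Fin d))) :
    trMul F (s • u) v = s * trMul F u v := by
  unfold trMul
  rw [← smul_eq_mul, ← map_smul]
  congr 1
  ext; simp

lemma trMul_sum_left {ι : Type*} (s : Finset ι) (u : ι → MonoidAlgebra F (Equiv.Perm (Fin d)))
    (v : MonoidAlgebra F (Equiv.Perm (Fin d))) :
    trMul F (∑ i ∈ s, u i) v = ∑ i ∈ s, trMul F (u i) v := by
  classical
  induction s using Finset.induction_on with
  | empty =>
    have := trMul_smul_left F 0 0 v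
    simpa using this
  | insert a s ha ih => rw [Finset.sum_insert ha, Finset.sum_insert ha, trMul_add_left, ih]

lemma trMul_single (g : Equiv.Perm (Fin d)) (v : MonoidAlgebra F (Equiv.Perm (Fin d))) :
    trMul F (MonoidAlgebra.single g 1) v = ∑ x, v.coeff (x⁻¹ * g⁻¹ * x) := by
  unfold trMul
  rw [LinearMap.trace_eq_matrix_trace F (MonoidAlgebra.basis (Equiv.Perm (Fin d)) F),
    Matrix.trace]
  refine Finset.sum_congr rfl fun x _ => ?_
  rw [Matrix.diag_apply, LinearMap.toMatrix_apply]
  have : ∀ y : MonoidAlgebra F (Equiv.Perm (Fin d)),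
      (MonoidAlgebra.basis (Equiv.Perm (Fin d)) F).repr y x = y.coeff x := fun y => rfl
  rw [this, MonoidAlgebra.basis_apply]
  simp [mul_assoc]

lemma sum_coeff_smul_single (v : MonoidAlgebra F (Equiv.Perm (Fin d))) :
    v = ∑ g, v.coeff g • MonoidAlgebra.single g (1 : F) := by
  ext x
  simp [MonoidAlgebra.coeff_single]

lemma trMul_eq_sum (u v : MonoidAlgebra F (Equiv.Perm (Fin d))) :
    trMul F u v = ∑ g, u.coeff g * trMul F (MonoidAlgebra.single g 1) v := by
  conv_lhs => rw [sum_coeff_smul_single F u]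
  rw [trMul_sum_left]
  exact Finset.sum_congr rfl fun g _ => trMul_smul_left F _ _ _

lemma trMul_conj (g h : Equiv.Perm (Fin d)) (v : MonoidAlgebra F (Equiv.Perm (Fin d))) :
    trMul F (MonoidAlgebra.single (h * g * h⁻¹) 1) v = trMul F (MonoidAlgebra.single g 1) v := by
  rw [trMul_single, trMul_single, ← Equiv.sum_comp (Equiv.mulLeft h)]
  refine Finset.sum_congr rfl fun x _ => ?_
  congr 1
  simp only [Equiv.coe_mulLeft]
  group

/-- The inner product of two characters given by elements of the group algebra. -/
lemma sum_trMul_mul_trMul (u v : MonoidAlgebra F (Equiv.Perm (Fin d))) :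
    ∑ g : Equiv.Perm (Fin d), trMul F (MonoidAlgebra.single g 1) u *
      trMul F (MonoidAlgebra.single g⁻¹ 1) v = (d.factorial : F) * trMul F u v := by
  have h1 : ∀ g : Equiv.Perm (Fin d), trMul F (MonoidAlgebra.single g 1) u *
      trMul F (MonoidAlgebra.single g⁻¹ 1) v =
      ∑ x : Equiv.Perm (Fin d), u.coeff (x⁻¹ * g⁻¹ * x) *
        trMul F (MonoidAlgebra.single (x⁻¹ * g⁻¹ * x) 1) v := by
    intro g
    rw [trMul_single F g u, Finset.sum_mul]
    refine Finset.sum_congr rfl fun x _ => ?_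
    congr 1
    have := trMul_conj F g⁻¹ x⁻¹ v
    rw [inv_inv] at this
    exact this.symm
  simp_rw [h1]
  rw [Finset.sum_comm]
  -- For fixed `x` the map g ↦ x⁻¹ g⁻¹ x is a bijection, so the inner sum does not depend on `x` and
  -- occurs d! times.
  have h2 : ∀ x : Equiv.Perm (Fin d), ∑ g : Equiv.Perm (Fin d), u.coeff (x⁻¹ * g⁻¹ * x) *
        trMul F (MonoidAlgebra.single (x⁻¹ * g⁻¹ * x) 1) v = trMul F u v := by
    intro x
    rw [trMul_eq_sum F u v]
    symm
    rw [← Equiv.sum_comp ((Equiv.inv _).trans (MulAut.conj x⁻¹).toEquiv)]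
    exact Finset.sum_congr rfl fun g _ => by simp
  rw [Finset.sum_congr rfl fun x _ => h2 x, Finset.sum_const, Finset.card_univ,
    Fintype.card_perm, Fintype.card_fin, nsmul_eq_mul]

lemma trMul_eq_zero {u v : MonoidAlgebra F (Equiv.Perm (Fin d))} (h : ∀ x, u * x * v = 0) :
    trMul F u v = 0 := by
  unfold trMul
  rw [show LinearMap.mulLeft F u ∘ₗ LinearMap.mulRight F v = 0 from ?_, map_zero]
  refine LinearMap.ext fun x => ?_
  simp [← mul_assoc, h]

/-- Only the identity preserves both rows and columns, so 1 arises from a single product. -/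
lemma coeff_youngSymmetrizer_one (l : Nat.Partition d) :
    (youngSymmetrizer F l).coeff 1 = 1 := by
  have h0 : (youngSymmetrizer F l).coeff 1 = (MonoidAlgebra.basis (Equiv.Perm (Fin d)) F).coord 1
    (youngSymmetrizer F l) := rfl
  rw [h0, youngSymmetrizer_eq, stabSum, signSum, Finset.sum_mul_sum, map_sum]
  simp_rw [map_sum, MonoidAlgebra.single_mul_single]
  have h1 : ∀ (g : Equiv.Perm (Fin d)) (a : F),
      (MonoidAlgebra.basis (Equiv.Perm (Fin d)) F).coord 1 (MonoidAlgebra.single g a) =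
        if g = 1 then a else 0 := by
    intro g a
    change (MonoidAlgebra.single g a).coeff 1 = _
    rw [MonoidAlgebra.coeff_single, Finsupp.single_apply]
  simp_rw [h1]
  rw [Finset.sum_eq_single_of_mem 1 (by simp), Finset.sum_eq_single_of_mem 1 (by simp)]
  · simp
  · intro q _ hq
    rw [if_neg]; simpa using hq
  · intro p hp hp1
    apply Finset.sum_eq_zero
    intro q hq
    rw [if_neg]
    intro hpq
    simp only [Finset.mem_filter_univ] at hp hq
    have hpe : p = q⁻¹ := eq_inv_of_mul_eq_one_left hpq
    apply hp1
    ext i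
    congr 1
    apply row_col_inj l
    · rw [hp]; rfl
    · rw [hpe, inv_mem_stab hq]; rfl

variable [CharZero F]

/-- If the scalar were zero, right multiplication by the symmetrizer would be nilpotent, hence of
trace 0. Its trace is d! times the coefficient at 1, that is d!, which is nonzero in characteristic
0. -/
lemma exists_youngSymmetrizer_mul_self (l : Nat.Partition d) : ∃ κ : F, κ ≠ 0 ∧
    youngSymmetrizer F l * youngSymmetrizer F l = κ • youngSymmetrizer F l := by
  obtain ⟨κ, hκ⟩ := exists_stabSum_mul_signSum_eq_smul F l
    (signSum F (col l) * stabSum F (row l))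
  have hκ' : youngSymmetrizer F l * youngSymmetrizer F l = κ • youngSymmetrizer F l := by
    rw [← hκ, youngSymmetrizer_eq]
    simp only [mul_assoc]
  refine ⟨κ, ?_, hκ'⟩
  rintro rfl
  rw [zero_smul] at hκ'
  have h1 : trMul F (MonoidAlgebra.single 1 1) (youngSymmetrizer F l) = (d.factorial : F) := by
    rw [trMul_single]
    simp [coeff_youngSymmetrizer_one, Fintype.card_perm]
  have h2 : IsNilpotent (LinearMap.mulRight F (youngSymmetrizer F l)) := by
    refine ⟨2, ?_⟩
    refine LinearMap.ext fun x => ?_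
    rw [pow_two, Module.End.mul_apply, LinearMap.mulRight_apply, LinearMap.mulRight_apply,
      mul_assoc, hκ', mul_zero]
    rfl
  have h3 := (LinearMap.isNilpotent_trace_of_isNilpotent h2).eq_zero
  have h4 : LinearMap.mulLeft F (MonoidAlgebra.single (1 : Equiv.Perm (Fin d)) (1 : F)) ∘ₗ
      LinearMap.mulRight F (youngSymmetrizer F l) =
      LinearMap.mulRight F (youngSymmetrizer F l) := by
    refine LinearMap.ext fun x => ?_
    simp [← MonoidAlgebra.one_def]
  rw [trMul, h4, h3] at h1
  exact Nat.cast_ne_zero.2 d.factorial_ne_zero h1.symm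

/-- The scalar by which a Young symmetrizer differs from an idempotent. -/
noncomputable def youngScalar (l : Nat.Partition d) : F :=
  (exists_youngSymmetrizer_mul_self F l).choose

lemma youngScalar_ne_zero (l : Nat.Partition d) : youngScalar F l ≠ 0 :=
  (exists_youngSymmetrizer_mul_self F l).choose_spec.1

lemma youngSymmetrizer_mul_self (l : Nat.Partition d) :
    youngSymmetrizer F l * youngSymmetrizer F l = youngScalar F l • youngSymmetrizer F l :=
  (exists_youngSymmetrizer_mul_self F l).choose_spec.2

/-- The primitive idempotent attached to a partition. -/
noncomputable def youngIdem (l : Nat.Partition d) : MonoidAlgebra F (Equiv.Perm (Fin d)) :=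
  (youngScalar F l)⁻¹ • youngSymmetrizer F l

lemma youngSymmetrizer_mul_youngIdem (l : Nat.Partition d) :
    youngSymmetrizer F l * youngIdem F l = youngSymmetrizer F l := by
  rw [youngIdem, mul_smul_comm, youngSymmetrizer_mul_self, smul_smul,
    inv_mul_cancel₀ (youngScalar_ne_zero F l), one_smul]

/-- Right multiplication by the idempotent projects the group algebra onto H_l, so the trace on H_l
can be computed on the whole algebra. -/
theorem irrChar_eq_trMul (l : Nat.Partition d) (σ : Equiv.Perm (Fin d)) :
    irrChar F l σ = trMul F (MonoidAlgebra.single σ 1) (youngIdem F l) := by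
  have key : ∀ y : MonoidAlgebra F (Equiv.Perm (Fin d)),
      Representation.leftRegular F (Equiv.Perm (Fin d)) σ y = MonoidAlgebra.single σ 1 * y := by
    intro y
    induction y using MonoidAlgebra.induction_linear with
    | zero => simp
    | add x y hx hy => rw [map_add, hx, hy, mul_add]
    | single h a => simp [Representation.ofMulAction_single]
  have hmem : ∀ x, (LinearMap.mulLeft F (MonoidAlgebra.single σ 1) ∘ₗ
      LinearMap.mulRight F (youngIdem F l)) x ∈ (spechtModule F l).toSubmodule := by
    intro x
    refine ⟨(youngScalar F l)⁻¹ • (MonoidAlgebra.single σ 1 * x), ?_⟩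
    simp [youngIdem, mul_assoc]
  rw [trMul, ← LinearMap.trace_restrict_eq_of_forall_mem _ _ hmem]
  unfold irrChar Representation.character
  congr 1
  ext1 ⟨y, hy⟩
  apply Subtype.ext
  obtain ⟨x, rfl⟩ := hy
  change Representation.leftRegular F (Equiv.Perm (Fin d)) σ _ = _
  rw [key]
  simp [mul_assoc, youngSymmetrizer_mul_youngIdem]

lemma irrChar_conj (l : Nat.Partition d) (g h : Equiv.Perm (Fin d)) :
    irrChar F l (h * g * h⁻¹) = irrChar F l g := by
  rw [irrChar_eq_trMul, irrChar_eq_trMul, trMul_conj]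

lemma sum_stab_irrChar (l : Nat.Partition d) {ι : Type*} [DecidableEq ι] (f : Fin d → ι) :
    ∑ σ : Equiv.Perm (Fin d) with ∀ i, f (σ i) = f i, irrChar F l σ =
      trMul F (stabSum F f) (youngIdem F l) := by
  rw [stabSum, trMul_sum_left]
  exact Finset.sum_congr rfl fun σ _ => irrChar_eq_trMul F l σ

lemma sum_stab_irrChar_eq_zero (l : Nat.Partition d) {f : Fin d → ℕ} (h : ¬ Dominated f l) :
    ∑ σ : Equiv.Perm (Fin d) with ∀ i, f (σ i) = f i, irrChar F l σ = 0 := by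
  rw [sum_stab_irrChar]
  apply trMul_eq_zero
  intro x
  rw [youngIdem, mul_smul_comm, youngSymmetrizer_eq, ← mul_assoc, mul_assoc (stabSum F f),
    stabSum_mul_signSum_eq_zero F h, smul_zero]

/-- The operator in question maps everything into the line spanned by the symmetrizer, so its trace
is its eigenvalue there, the order of the row group. -/
lemma sum_stab_row_irrChar (l : Nat.Partition d) :
    ∑ σ : Equiv.Perm (Fin d) with ∀ i, row l (σ i) = row l i, irrChar F l σ =
      (#{p : Equiv.Perm (Fin d) | ∀ i, row l (p i) = row l i} : F) := by
  rw [sum_stab_irrChar]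
  set c := youngSymmetrizer F l with hc
  set r : F := (#{p : Equiv.Perm (Fin d) | ∀ i, row l (p i) = row l i} : F) with hr
  set L := LinearMap.mulLeft F (stabSum F (row l)) ∘ₗ LinearMap.mulRight F (youngIdem F l) with hL
  have h1 : ∀ x, ∃ s : F, L x = s • c := by
    intro x
    obtain ⟨s, hs⟩ := exists_stabSum_mul_signSum_eq_smul F l (x * stabSum F (row l))
    refine ⟨(youngScalar F l)⁻¹ * s, ?_⟩
    rw [mul_smul, ← hs, hL]
    simp [youngIdem, youngSymmetrizer_eq, mul_assoc]
  have h2 : L c = r • c := by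
    rw [hL, LinearMap.comp_apply, LinearMap.mulRight_apply, LinearMap.mulLeft_apply,
      youngSymmetrizer_mul_youngIdem, hc, youngSymmetrizer_eq, ← mul_assoc, stabSum_mul_stabSum,
      smul_mul_assoc]
  set φ := (MonoidAlgebra.basis (Equiv.Perm (Fin d)) F).coord 1 with hφ
  have hφc : φ c = 1 := coeff_youngSymmetrizer_one F l
  have h3 : L = (φ ∘ₗ L).smulRight c := by
    refine LinearMap.ext fun x => ?_
    obtain ⟨s, hs⟩ := h1 x
    change L x = φ (L x) • c
    rw [hs, map_smul, hφc, smul_eq_mul, mul_one]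
  rw [trMul, ← hL, h3, LinearMap.trace_smulRight, LinearMap.comp_apply, h2, map_smul, hφc,
    smul_eq_mul, mul_one]

/-- The sum is d! times the trace of x ↦ e_l x e_m, and the inner product of column sum, x and row
sum already vanishes. -/
lemma sum_irrChar_mul_irrChar_eq_zero {l m : Nat.Partition d} (h : ¬ Dominated (row m) l) :
    ∑ σ : Equiv.Perm (Fin d), irrChar F l σ * irrChar F m σ⁻¹ = 0 := by
  simp_rw [irrChar_eq_trMul]
  rw [sum_trMul_mul_trMul, trMul_eq_zero, mul_zero]
  intro x
  have := signSum_mul_stabSum_eq_zero F h x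
  simp only [youngIdem, youngSymmetrizer_eq, smul_mul_assoc, mul_smul_comm]
  rw [show stabSum F (row l) * signSum F (col l) * x * (stabSum F (row m) * signSum F (col m)) =
    stabSum F (row l) * (signSum F (col l) * x * stabSum F (row m)) * signSum F (col m) by
      simp only [mul_assoc], this]
  simp

end Characters
end TypeI

namespace TypeI
open Finset MvPolynomial

/-! ### Power sums and cycle types -/

section Cycles
variable {d : ℕ}

lemma comp_eq_iff_sameCycle {ι : Type*} {σ : Equiv.Perm (Fin d)} {f : Fin d → ι} :
    f ∘ σ = f ↔ ∀ i j, σ.SameCycle i j → f i = f j := by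
  constructor
  · rintro h i j ⟨k, rfl⟩
    have hσ : ∀ i, f (σ i) = f i := fun i => congrFun h i
    have hσ' : ∀ i, f (σ⁻¹ i) = f i := fun i => by rw [← hσ]; simp
    induction k using Int.induction_on generalizing i with
    | zero => simp
    | succ k ih => rw [zpow_add_one, Equiv.Perm.mul_apply, ← ih (σ i), hσ]
    | pred k ih => rw [zpow_sub_one, Equiv.Perm.mul_apply, ← ih (σ⁻¹ i), hσ']
  · intro h
    funext i
    exact (h i (σ i) (Equiv.Perm.SameCycle.refl σ i |>.apply_right)).symm

-- Orbits meeting the support correspond to cycle factors; the others are single points, the parts 1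
-- of the cycle partition.
open Classical in
lemma prod_quotient_sameCycle {M : Type*} [CommMonoid M] (σ : Equiv.Perm (Fin d)) (g : ℕ → M) :
    ∏ q : Quotient (Equiv.Perm.SameCycle.setoid σ),
      g #{i | (Quotient.mk (Equiv.Perm.SameCycle.setoid σ) i) = q} =
      (σ.partition.parts.map g).prod := by
  have hmk : ∀ i j, Quotient.mk (Equiv.Perm.SameCycle.setoid σ) i =
      Quotient.mk (Equiv.Perm.SameCycle.setoid σ) j ↔ σ.SameCycle i j := fun i j => Quotient.eq
  have hout : ∀ q : Quotient (Equiv.Perm.SameCycle.setoid σ),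
      Quotient.mk (Equiv.Perm.SameCycle.setoid σ) q.out = q := fun q => Quotient.out_eq q
  rw [Equiv.Perm.parts_partition, Multiset.map_add, Multiset.prod_add, Multiset.map_replicate,
    Multiset.prod_replicate,
    ← Finset.prod_filter_mul_prod_filter_not univ (fun q => q.out ∈ σ.support)]
  congr 1
  · rw [Equiv.Perm.cycleType_def, Multiset.map_map]
    change _ = ∏ c ∈ σ.cycleFactorsFinset, g #c.support
    refine Finset.prod_bij (fun q _ => σ.cycleOf q.out) ?_ ?_ ?_ ?_
    · intro q hq
      rw [Finset.mem_filter_univ] at hq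
      rwa [Equiv.Perm.cycleOf_mem_cycleFactorsFinset_iff]
    · intro q hq r hr h
      rw [Finset.mem_filter_univ] at hq hr
      rw [← hout q, ← hout r, hmk]
      have h1 : r.out ∈ (σ.cycleOf q.out).support := by
        rw [h, Equiv.Perm.mem_support_cycleOf_iff]
        exact ⟨Equiv.Perm.SameCycle.refl _ _, hr⟩
      exact (Equiv.Perm.mem_support_cycleOf_iff.1 h1).1
    · intro c hc
      obtain ⟨x, hx⟩ : c.support.Nonempty := by
        rw [Finset.nonempty_iff_ne_empty, Ne, Equiv.Perm.support_eq_empty_iff]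
        exact ((Equiv.Perm.mem_cycleFactorsFinset_iff.1 hc).1).ne_one
      have hcx := Equiv.Perm.cycle_is_cycleOf hx hc
      have hs : σ.SameCycle (Quotient.mk (Equiv.Perm.SameCycle.setoid σ) x).out x :=
        (hmk _ _).1 (hout _)
      refine ⟨Quotient.mk _ x, ?_, ?_⟩
      · rw [Finset.mem_filter_univ, ← Equiv.Perm.cycleOf_mem_cycleFactorsFinset_iff,
          hs.cycleOf_eq, ← hcx]
        exact hc
      · rw [hs.cycleOf_eq, ← hcx]
    · intro q hq
      rw [Finset.mem_filter_univ] at hq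
      congr 2
      ext i
      rw [Finset.mem_filter_univ, Equiv.Perm.mem_support_cycleOf_iff]
      conv_lhs => rw [← hout q, hmk]
      exact ⟨fun h => ⟨h.symm, hq⟩, fun h => h.1.symm⟩
  · rw [Finset.prod_congr rfl (g := fun _ => g 1), Finset.prod_const]
    · congr 1
      rw [← Finset.card_compl]
      refine Finset.card_bij (fun q _ => q.out) ?_ ?_ ?_
      · intro q hq; simpa using hq
      · intro q _ r _ h
        rw [← hout q, ← hout r, h]
      · intro x hx
        have hs : σ.SameCycle x (Quotient.mk (Equiv.Perm.SameCycle.setoid σ) x).out :=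
          ((hmk _ _).1 (hout _)).symm
        have hfix : σ x = x := by simpa using hx
        have hxo := hs.eq_of_left hfix
        refine ⟨Quotient.mk _ x, ?_, hxo.symm⟩
        rw [Finset.mem_filter_univ, ← hxo]
        simpa using hfix
    · intro q hq
      rw [Finset.mem_filter_univ] at hq
      congr 1
      rw [Finset.card_eq_one]
      refine ⟨q.out, ?_⟩
      ext i
      rw [Finset.mem_filter_univ, Finset.mem_singleton]
      conv_lhs => rw [← hout q, hmk]
      constructor
      · intro h
        exact (h.symm.eq_of_left (by simpa [Function.IsFixedPt] using hq)).symm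
      · rintro rfl; exact Equiv.Perm.SameCycle.refl _ _

/-- A fixed colouring is a free choice of colour for each orbit, so the sum factors with one power
sum per cycle. -/
theorem fixPoly_eq_prod_psum (N : ℕ) (σ : Equiv.Perm (Fin d)) :
    fixPoly N σ = (σ.partition.parts.map (psum (Fin N) ℤ)).prod := by
  classical
  rw [← prod_quotient_sameCycle σ]
  simp only [psum]
  rw [Finset.prod_univ_sum, Fintype.piFinset_univ, fixPoly]
  refine Finset.sum_bij' (fun f _ q => f q.out)
    (fun F _ i => F (Quotient.mk (Equiv.Perm.SameCycle.setoid σ) i)) ?_ ?_ ?_ ?_ ?_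
  · simp
  · intro F _
    rw [Finset.mem_filter_univ, comp_eq_iff_sameCycle]
    intro i j hij
    exact congrArg F (Quotient.eq.2 hij)
  · intro f hf
    rw [Finset.mem_filter_univ, comp_eq_iff_sameCycle] at hf
    funext i
    exact hf _ _ (Quotient.mk_out (s := Equiv.Perm.SameCycle.setoid σ) i)
  · intro F _
    funext q
    simp
  · intro f hf
    rw [Finset.mem_filter_univ, comp_eq_iff_sameCycle] at hf
    rw [← Finset.prod_fiberwise univ (Quotient.mk (Equiv.Perm.SameCycle.setoid σ))]
    refine Finset.prod_congr rfl fun q _ => ?_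
    rw [Finset.prod_congr rfl (g := fun _ => (X (f q.out) : MvPolynomial (Fin N) ℤ)),
      Finset.prod_const]
    intro i hi
    rw [← (Finset.mem_filter.1 hi).2]
    rw [hf _ _ (Quotient.mk_out (s := Equiv.Perm.SameCycle.setoid σ) i)]

end Cycles

/-- The coefficient of the Schur polynomial `s_l` in a product of power sums. -/
noncomputable def frobM (N : ℕ) {d : ℕ} (l : Nat.Partition d) (m : Multiset ℕ) : ℤ :=
  coeff (toFsupp (expo N ⟨d, l⟩)) ((m.map (psum (Fin N) ℤ)).prod * alternant N (stair N))

lemma frob_eq_frobM (N : ℕ) {d : ℕ} (l : Nat.Partition d) (σ : Equiv.Perm (Fin d)) :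
    frob N l σ = frobM N l σ.partition.parts := by
  rw [frob, frobM, fixPoly_eq_prod_psum]

/-- The cycle type of a permutation of `Fin d`, as a partition of `d`. -/
def cycPtn {d : ℕ} (σ : Equiv.Perm (Fin d)) : Nat.Partition d where
  parts := σ.partition.parts
  parts_pos := σ.partition.parts_pos
  parts_sum := by rw [σ.partition.parts_sum, Fintype.card_fin]

lemma isConj_of_cycPtn_eq {d : ℕ} {σ τ : Equiv.Perm (Fin d)} (h : cycPtn σ = cycPtn τ) :
    IsConj σ τ :=
  Equiv.Perm.partition_eq_of_isConj.2 (Nat.Partition.ext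
    (show σ.partition.parts = τ.partition.parts from
      congrArg (fun r : Nat.Partition d => r.parts) h))

/-- The number of permutations of a given cycle type. -/
def classSize {d : ℕ} (r : Nat.Partition d) : ℕ := #{σ : Equiv.Perm (Fin d) | cycPtn σ = r}

lemma sum_classSize_mul {d N : ℕ} (hN : d ≤ N) (l m : Nat.Partition d) :
    ∑ r : Nat.Partition d, (classSize r : ℤ) * (frobM N l r.parts * frobM N m r.parts) =
      if l = m then (d.factorial : ℤ) else 0 := by
  rw [← sum_frob_mul_frob hN, ← Finset.sum_fiberwise univ cycPtn]
  refine Finset.sum_congr rfl fun r _ => ?_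
  rw [Finset.sum_congr rfl (g := fun _ => frobM N l r.parts * frobM N m r.parts),
    Finset.sum_const, nsmul_eq_mul]
  · rfl
  · intro σ hσ
    rw [Finset.mem_filter_univ] at hσ
    rw [frob_eq_frobM, frob_eq_frobM, ← hσ]
    rfl

/-- The second orthogonality relation. -/
theorem sum_frobM_mul_frobM {d N : ℕ} (hN : d ≤ N) (r t : Nat.Partition d) :
    (∑ l : Nat.Partition d, frobM N l r.parts * frobM N l t.parts) * classSize t =
      if r = t then (d.factorial : ℤ) else 0 := by
  have hd : (d.factorial : ℚ) ≠ 0 := Nat.cast_ne_zero.2 d.factorial_ne_zero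
  let P : Matrix (Nat.Partition d) (Nat.Partition d) ℚ :=
    Matrix.of fun l t => (frobM N l t.parts : ℚ) * classSize t / d.factorial
  let Q : Matrix (Nat.Partition d) (Nat.Partition d) ℚ :=
    Matrix.of fun r l => (frobM N l r.parts : ℚ)
  have hPQ : P * Q = 1 := by
    ext l m
    rw [Matrix.mul_apply, Matrix.one_apply]
    have h := congrArg (fun z : ℤ => (z : ℚ) / d.factorial) (sum_classSize_mul hN l m)
    simp only [Int.cast_sum, Finset.sum_div] at h
    rw [show (if l = m then (1 : ℚ) else 0) =
      ((if l = m then (d.factorial : ℤ) else 0 : ℤ) : ℚ) / d.factorial by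
        split_ifs <;> simp [hd], ← h]
    refine Finset.sum_congr rfl fun t _ => ?_
    simp only [P, Q, Matrix.of_apply]
    push_cast
    ring
  -- Rows and columns are both indexed by partitions of d, so a one-sided inverse is two-sided; this
  -- exchanges the two orthogonality relations.
  have hQP1 : Q * P = 1 := mul_eq_one_comm.1 hPQ
  have hQP := congrFun (congrFun hQP1 r) t
  rw [Matrix.mul_apply, Matrix.one_apply] at hQP
  have h2 : ((∑ l : Nat.Partition d, frobM N l r.parts * frobM N l t.parts : ℤ) : ℚ) *
      classSize t = (if r = t then (1 : ℚ) else 0) * d.factorial := by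
    rw [← hQP, Int.cast_sum, Finset.sum_mul, Finset.sum_mul]
    refine Finset.sum_congr rfl fun l _ => ?_
    simp only [P, Q, Matrix.of_apply]
    push_cast
    field_simp
  have h3 : (((∑ l : Nat.Partition d, frobM N l r.parts * frobM N l t.parts) * classSize t : ℤ) : ℚ)
      = ((if r = t then (d.factorial : ℤ) else 0 : ℤ) : ℚ) := by
    rw [Int.cast_mul, Int.cast_natCast, h2]
    split_ifs <;> simp
  exact_mod_cast h3

/-- The diagonal case of the second orthogonality relation has d! on the right, so no permutation
need be constructed. -/
lemma classSize_ne_zero {d : ℕ} (r : Nat.Partition d) : classSize r ≠ 0 := by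
  intro h
  have := sum_frobM_mul_frobM le_rfl r r
  rw [h, if_pos rfl] at this
  simp only [Nat.cast_zero, mul_zero] at this
  exact d.factorial_ne_zero (by exact_mod_cast this.symm)

lemma exists_cycPtn_eq {d : ℕ} (r : Nat.Partition d) : ∃ σ, cycPtn σ = r := by
  obtain ⟨σ, hσ⟩ := Finset.card_pos.1 (Nat.pos_of_ne_zero (classSize_ne_zero r))
  exact ⟨σ, by simpa using hσ⟩

/-! ### The Frobenius character formula -/

section Frobenius
variable (F : Type*) [Field F] {d N : ℕ}

/-- The pairing of an irreducible character with a coefficient function. -/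
noncomputable def charPairing (N : ℕ) (l m : Nat.Partition d) : F :=
  ∑ σ : Equiv.Perm (Fin d), irrChar F l σ * (frob N m σ : F)

lemma sum_fixCount_mul_irrChar (l : Nat.Partition d) (a : Fin N → ℕ) :
    ∑ σ : Equiv.Perm (Fin d), (fixCount a σ : F) * irrChar F l σ =
      ∑ f : Fin d → Fin N with (∀ p, #{i | f i = p} = a p),
        ∑ σ : Equiv.Perm (Fin d) with ∀ i, f (σ i) = f i, irrChar F l σ := by
  simp_rw [Finset.sum_filter (s := (univ : Finset (Equiv.Perm (Fin d))))]
  rw [Finset.sum_comm]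
  refine Finset.sum_congr rfl fun σ _ => ?_
  rw [← Finset.sum_filter, Finset.filter_filter, Finset.sum_const, nsmul_eq_mul, fixCount]
  simp only [funext_iff, Function.comp_apply, and_comm]

lemma charPairing_eq_sum (l m : Nat.Partition d) : charPairing F N l m =
    ∑ w : Equiv.Perm (Fin N), ((Equiv.Perm.sign w : ℤ) : F) *
      if ∀ i, stair N (w i) ≤ expo N ⟨d, m⟩ i then
        ∑ σ : Equiv.Perm (Fin d),
          (fixCount (fun i => expo N ⟨d, m⟩ i - stair N (w i)) σ : F) * irrChar F l σ else 0 := by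
  simp only [charPairing, frob_eq_sum, Int.cast_sum, Finset.mul_sum]
  rw [Finset.sum_comm]
  refine Finset.sum_congr rfl fun w _ => ?_
  split_ifs with h
  · rw [Finset.mul_sum]
    refine Finset.sum_congr rfl fun σ _ => ?_
    push_cast
    ring
  · simp

variable [CharZero F]

/-- By the second orthogonality relation the kernel Σ_m `frob m g` · `frob m σ` is supported on the
class of σ, where the class function χ_l is constant. -/
lemma factorial_mul_irrChar (hN : d ≤ N) (l : Nat.Partition d) (σ : Equiv.Perm (Fin d)) :
    (d.factorial : F) * irrChar F l σ = ∑ m, charPairing F N l m * (frob N m σ : F) := by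
  have hw : (classSize (cycPtn σ) : F) ≠ 0 := Nat.cast_ne_zero.2 (classSize_ne_zero _)
  apply mul_right_cancel₀ hw
  simp only [charPairing, Finset.sum_mul]
  rw [Finset.sum_comm]
  have h1 : ∀ g : Equiv.Perm (Fin d), ∑ m, irrChar F l g * (frob N m g : F) * (frob N m σ : F) *
      (classSize (cycPtn σ) : F) =
      if cycPtn g = cycPtn σ then (d.factorial : F) * irrChar F l σ else 0 := by
    intro g
    have h2 := congrArg (Int.cast : ℤ → F) (sum_frobM_mul_frobM hN (cycPtn g) (cycPtn σ))
    rw [Int.cast_mul, Int.cast_sum, Int.cast_natCast] at h2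
    have h3 : ∑ m, irrChar F l g * (frob N m g : F) * (frob N m σ : F) *
      (classSize (cycPtn σ) : F) = irrChar F l g * ((∑ m : Nat.Partition d,
        ((frobM N m (cycPtn g).parts * frobM N m (cycPtn σ).parts : ℤ) : F)) *
          (classSize (cycPtn σ) : F)) := by
      rw [Finset.sum_mul, Finset.mul_sum]
      refine Finset.sum_congr rfl fun m _ => ?_
      rw [frob_eq_frobM, frob_eq_frobM, Int.cast_mul]
      simp only [cycPtn]
      ring
    rw [h3, h2]
    split_ifs with h
    · obtain ⟨c, hc⟩ := isConj_iff.1 (isConj_of_cycPtn_eq h)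
      rw [← hc, irrChar_conj]
      push_cast; ring
    · simp
  rw [Finset.sum_congr rfl fun g _ => h1 g, ← Finset.sum_filter, Finset.sum_const, nsmul_eq_mul,
    mul_comm]
  rfl

lemma sum_charPairing_mul (hN : d ≤ N) (l m : Nat.Partition d) :
    ∑ k, charPairing F N m k * charPairing F N l k =
      (d.factorial : F) * ∑ σ : Equiv.Perm (Fin d), irrChar F l σ * irrChar F m σ⁻¹ := by
  rw [Finset.mul_sum]
  have h1 : ∀ σ : Equiv.Perm (Fin d), (d.factorial : F) * (irrChar F l σ * irrChar F m σ⁻¹) =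
      ∑ k, charPairing F N m k * (irrChar F l σ * (frob N k σ : F)) := by
    intro σ
    rw [mul_left_comm, factorial_mul_irrChar F hN, Finset.mul_sum]
    refine Finset.sum_congr rfl fun k _ => ?_
    rw [frob_inv]; ring
  simp_rw [h1]
  rw [Finset.sum_comm]
  refine Finset.sum_congr rfl fun k _ => ?_
  rw [← Finset.mul_sum, charPairing, charPairing]

/-! ### Triangularity and diagonality of the character pairing. -/

lemma row_lt (l : Nat.Partition d) (i : Fin d) : row l i < d :=
  lt_of_lt_of_le ((rowComposition l).index i).2 (rowComposition l).length_le

/-- The rows of the standard tableau, as a colouring. -/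
def rowFin (hN : d ≤ N) (l : Nat.Partition d) (i : Fin d) : Fin N :=
  ⟨row l i, (row_lt l i).trans_le hN⟩

lemma card_rowFin_eq (hN : d ≤ N) (l : Nat.Partition d) (p : Fin N) :
    #{i | rowFin hN l i = p} = part ⟨d, l⟩ p := by
  rw [← card_row_eq]
  simp [rowFin, Fin.ext_iff]

lemma card_val_lt {a : Fin N → ℕ} {f : Fin d → Fin N} (hf : ∀ p, #{i | f i = p} = a p) (k : ℕ) :
    #{i | (f i : ℕ) < k} = ∑ p : Fin N, if (p : ℕ) < k then a p else 0 := by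
  rw [Finset.card_eq_sum_card_fiberwise (f := f) (t := univ) (by simp)]
  refine Finset.sum_congr rfl fun p _ => ?_
  rw [Finset.filter_filter]
  split_ifs with h
  · rw [← hf p]
    congr 1
    ext i
    simp only [Finset.mem_filter_univ]
    exact ⟨fun h => h.2, fun h2 => ⟨h2 ▸ h, h2⟩⟩
  · rw [Finset.card_eq_zero, Finset.filter_eq_empty_iff]
    rintro i _ ⟨h1, rfl⟩
    exact h h1

/-- The rearrangement inequality: the indicator of the first k places and the staircase are both
decreasing. -/
lemma sum_ite_stair_comp_le (w : Equiv.Perm (Fin N)) (k : ℕ) :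
    ∑ p : Fin N, (if (p : ℕ) < k then stair N (w p) else 0) ≤
      ∑ p : Fin N, if (p : ℕ) < k then stair N p else 0 := by
  have h1 : Antitone fun p : Fin N => if (p : ℕ) < k then 1 else 0 := by
    intro p q hpq
    dsimp only
    have : (p : ℕ) ≤ q := hpq
    split_ifs <;> omega
  have h := (h1.monovary (strictAnti_stair N).antitone).sum_mul_comp_perm_le_sum_mul (σ := w)
  simpa using h

lemma card_row_lt (hN : d ≤ N) (l : Nat.Partition d) (k : ℕ) :
    #{i | row l i < k} = ∑ p : Fin N, if (p : ℕ) < k then part ⟨d, l⟩ p else 0 :=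
  card_val_lt (card_rowFin_eq hN l) k

/-- The content μ + δ - wδ has partial sums at least those of μ, so a partition dominating it
dominates μ. If that partition is μ, the partial sums of wδ and δ agree, which forces w = 1. -/
lemma dominated_of_dominated (hN : d ≤ N) {l m : Nat.Partition d} {w : Equiv.Perm (Fin N)}
    (hw : ∀ i, stair N (w i) ≤ expo N ⟨d, m⟩ i) {f : Fin d → Fin N}
    (hf : ∀ p, #{i | f i = p} = expo N ⟨d, m⟩ p - stair N (w p))
    (h : Dominated (fun i => (f i : ℕ)) l) : Dominated (row m) l ∧ (l = m → w = 1) := by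
  have key : ∀ k, #{i | (f i : ℕ) < k} + ∑ p : Fin N, (if (p : ℕ) < k then stair N (w p) else 0) =
      #{i | row m i < k} + ∑ p : Fin N, if (p : ℕ) < k then stair N p else 0 := by
    intro k
    rw [card_val_lt hf, card_row_lt hN, ← Finset.sum_add_distrib, ← Finset.sum_add_distrib]
    refine Finset.sum_congr rfl fun p _ => ?_
    split_ifs
    · rw [Nat.sub_add_cancel (hw p)]
      rfl
    · rfl
  refine ⟨fun k => ?_, ?_⟩
  · have h1 := key k
    have h2 := sum_ite_stair_comp_le w k
    have h3 : #{i | (f i : ℕ) < k} ≤ _ := h k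
    omega
  · rintro rfl
    have h4 : ∀ k, ∑ p : Fin N, (if (p : ℕ) < k then stair N (w p) else 0) =
        ∑ p : Fin N, if (p : ℕ) < k then stair N p else 0 := by
      intro k
      have h1 := key k
      have h2 := sum_ite_stair_comp_le w k
      have h3 : #{i | (f i : ℕ) < k} ≤ _ := h k
      omega
    have h5 : ∀ (g : Fin N → ℕ) (q : Fin N),
        ∑ p : Fin N, (if (p : ℕ) < (q : ℕ) + 1 then g p else 0) =
        ∑ p : Fin N, (if (p : ℕ) < (q : ℕ) then g p else 0) + g q := by
      intro g q
      have : g q = ∑ p : Fin N, if p = q then g p else 0 := by simp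
      rw [this, ← Finset.sum_add_distrib]
      refine Finset.sum_congr rfl fun p _ => ?_
      simp only [Fin.ext_iff]
      split_ifs <;> omega
    ext1 q
    apply (strictAnti_stair N).injective
    have h6 := h4 (q + 1)
    rw [h5 (fun p => stair N (w p)), h5 (stair N), h4] at h6
    simpa using h6

lemma sum_stab_irrChar_of_content (hN : d ≤ N) (l : Nat.Partition d) {f : Fin d → Fin N}
    (hf : ∀ p, #{i | f i = p} = part ⟨d, l⟩ p) :
    ∑ σ : Equiv.Perm (Fin d) with ∀ i, f (σ i) = f i, irrChar F l σ =
      (#{σ : Equiv.Perm (Fin d) | f ∘ σ = f} : F) := by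
  obtain ⟨τ, rfl⟩ := exists_perm_of_content_eq (f := rowFin hN l) (g := f)
    (fun p => by rw [hf, card_rowFin_eq])
  have hiff : ∀ σ : Equiv.Perm (Fin d), (∀ i, (rowFin hN l ∘ τ) (σ i) = (rowFin hN l ∘ τ) i) ↔
      ∀ i, row l ((τ * σ * τ⁻¹) i) = row l i := by
    intro σ
    simp only [rowFin, Function.comp_apply, Fin.ext_iff]
    constructor
    · intro h i
      have := h (τ⁻¹ i)
      simpa using this
    · intro h i
      have := h (τ i)
      simpa using this
  have h1 := sum_stab_row_irrChar F l
  have h2 : ∑ σ : Equiv.Perm (Fin d) with ∀ i, (rowFin hN l ∘ τ) (σ i) = (rowFin hN l ∘ τ) i,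
      irrChar F l σ =
      ∑ σ : Equiv.Perm (Fin d) with ∀ i, row l (σ i) = row l i, irrChar F l σ := by
    refine Finset.sum_equiv (MulAut.conj τ).toEquiv ?_ ?_
    · intro σ
      simp only [Finset.mem_filter_univ, hiff]
      rfl
    · intro σ _
      exact (irrChar_conj F l σ τ).symm
  rw [h2, h1]
  congr 1
  symm
  refine Finset.card_equiv (MulAut.conj τ).toEquiv ?_
  intro σ
  rw [Finset.mem_filter_univ, Finset.mem_filter_univ, funext_iff]
  exact hiff σ

lemma charPairing_eq_zero (hN : d ≤ N) {l m : Nat.Partition d} (h : ¬ Dominated (row m) l) :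
    charPairing F N l m = 0 := by
  rw [charPairing_eq_sum]
  refine Finset.sum_eq_zero fun w _ => ?_
  split_ifs with hw
  · rw [sum_fixCount_mul_irrChar, Finset.sum_eq_zero, mul_zero]
    intro f hf
    rw [Finset.mem_filter_univ] at hf
    have := sum_stab_irrChar_eq_zero F l (f := fun i => (f i : ℕ))
      (fun hd => h (dominated_of_dominated hN hw hf hd).1)
    simpa [Fin.ext_iff] using this
  · simp

/-- Only w = 1 survives. There each colouring of content λ contributes the order of its stabilizer,
and orbit counting adds these up to d!. -/
lemma charPairing_self (hN : d ≤ N) (l : Nat.Partition d) :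
    charPairing F N l l = d.factorial := by
  rw [charPairing_eq_sum, Finset.sum_eq_single 1]
  · have h1 : ∀ i, stair N ((1 : Equiv.Perm (Fin N)) i) ≤ expo N ⟨d, l⟩ i :=
      fun i => Nat.le_add_left _ _
    have h2 : (fun i => expo N ⟨d, l⟩ i - stair N ((1 : Equiv.Perm (Fin N)) i)) =
        fun i : Fin N => part ⟨d, l⟩ i := by
      funext i
      simp [expo, stair]
    rw [if_pos h1, h2, sum_fixCount_mul_irrChar]
    have h3 : ∑ i : Fin N, part ⟨d, l⟩ i = d := by
      rw [← Finset.sum_range (fun i => part ⟨d, l⟩ i)]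
      exact sum_part_range ⟨d, l⟩ hN
    have h4 : ∑ f : Fin d → Fin N with (∀ p : Fin N, #{i | f i = p} = part ⟨d, l⟩ p),
        #{σ : Equiv.Perm (Fin d) | f ∘ σ = f} = d.factorial := by
      convert sum_card_stabilizer h3
    rw [← h4, Nat.cast_sum]
    simp only [Equiv.Perm.sign_one, Units.val_one, Int.cast_one, one_mul]
    refine Finset.sum_congr rfl fun f hf => ?_
    exact sum_stab_irrChar_of_content F hN l (Finset.mem_filter.1 hf).2
  · intro w _ hw1
    split_ifs with hw
    · rw [sum_fixCount_mul_irrChar, Finset.sum_eq_zero, mul_zero]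
      intro f hf
      rw [Finset.mem_filter_univ] at hf
      have := sum_stab_irrChar_eq_zero F l (f := fun i => (f i : ℕ))
        (fun hd => hw1 ((dominated_of_dominated hN hw hf hd).2 rfl))
      simpa [Fin.ext_iff] using this
    · simp
  · simp

lemma eq_of_card_row_lt_eq {l m : Nat.Partition d}
    (h : ∀ k ∈ range (d + 1), #{i | row m i < k} = #{i | row l i < k}) : m = l := by
  apply eq_of_part_eq
  intro r
  rcases lt_or_ge r d with hr | hr
  · have key : ∀ l : Nat.Partition d, #{i | row l i < r + 1} =
        #{i | row l i < r} + part ⟨d, l⟩ r := by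
      intro l
      have := card_lt_succ_and (row l) (fun _ => 0) r 0
      simpa [card_row_eq] using this
    have h1 := h (r + 1) (by simpa using hr)
    have h2 := h r (by simp; omega)
    rw [key, key, h2] at h1
    omega
  · rw [part_eq_zero _ hr, part_eq_zero _ hr]

/-- The total of all partial sums is a numerical rank for dominance: it yields antisymmetry and
serves as induction parameter. -/
lemma Dominated.sum_lt {l m : Nat.Partition d} (h : Dominated (row m) l) (hne : m ≠ l) :
    ∑ k ∈ range (d + 1), #{i | row m i < k} < ∑ k ∈ range (d + 1), #{i | row l i < k} := by
  refine lt_of_le_of_ne (Finset.sum_le_sum fun k _ => h k) fun heq => hne ?_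
  exact eq_of_card_row_lt_eq ((Finset.sum_eq_sum_iff_of_le fun k _ => h k).1 heq)

lemma sum_charPairing_mul_eq_zero (hN : d ≤ N) {l m : Nat.Partition d} (hne : m ≠ l) :
    ∑ k, charPairing F N m k * charPairing F N l k = 0 := by
  by_cases h : Dominated (row m) l
  · have h' : ¬ Dominated (row l) m := fun h' => lt_asymm (h.sum_lt hne) (h'.sum_lt hne.symm)
    simp_rw [mul_comm (charPairing F N m _)]
    rw [sum_charPairing_mul F hN, sum_irrChar_mul_irrChar_eq_zero F h', mul_zero]
  · rw [sum_charPairing_mul F hN, sum_irrChar_mul_irrChar_eq_zero F h, mul_zero]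

/-- Induction on the rank of `l`. A partition `m` strictly below `l` has a diagonal row by
induction, so orthogonality of the rows of `m` and `l` reduces to d! times the entry at `(l, m)`. -/
lemma charPairing_of_ne (hN : d ≤ N) (l : Nat.Partition d) :
    ∀ m, m ≠ l → charPairing F N l m = 0 := by
  induction hM : ∑ k ∈ range (d + 1), #{i | row l i < k} using Nat.strong_induction_on
    generalizing l with
  | _ M ih =>
    intro m hne
    by_cases h : Dominated (row m) l
    · have h1 := sum_charPairing_mul_eq_zero F hN hne
      rw [Finset.sum_eq_single m] at h1
      · rw [charPairing_self F hN] at h1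
        exact (mul_eq_zero.1 h1).resolve_left (Nat.cast_ne_zero.2 d.factorial_ne_zero)
      · intro k _ hk
        rw [ih _ (hM ▸ h.sum_lt hne) m rfl k hk, zero_mul]
      · simp
    · exact charPairing_eq_zero F hN h

/-- Frobenius' formula for the characters of the symmetric group. -/
theorem irrChar_eq_frob (hN : d ≤ N) (l : Nat.Partition d) (σ : Equiv.Perm (Fin d)) :
    irrChar F l σ = (frob N l σ : F) := by
  have h := factorial_mul_irrChar F hN l σ
  rw [Finset.sum_eq_single l, charPairing_self F hN] at h
  · exact mul_left_cancel₀ (Nat.cast_ne_zero.2 d.factorial_ne_zero) h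
  · intro m _ hm
    rw [charPairing_of_ne F hN l m hm, zero_mul]
  · simp

end Frobenius
end TypeI

namespace TypeI
open Finset MvPolynomial

/-! ### Littlewood-Richardson coefficients -/

lemma schur_eq_det (N : ℕ) (l : Ptn) : schur N l =
    algebraMap (MvPolynomial (Fin N) ℤ) (FractionRing (MvPolynomial (Fin N) ℤ))
      (jacobiTrudi N (expo N l)).det := by
  have h0 : algebraMap (MvPolynomial (Fin N) ℤ) (FractionRing (MvPolynomial (Fin N) ℤ))
      (alternant N (stair N)) ≠ 0 := by
    rw [Ne, FaithfulSMul.algebraMap_eq_zero_iff]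
    exact alternant_stair_ne_zero N
  have h1 : schur N l = algebraMap _ _ (alternant N (expo N l)) /
      algebraMap _ _ (alternant N (stair N)) := rfl
  rw [h1, div_eq_iff h0, ← map_mul, ← alternant_eq_det_mul]

lemma isSchurProduct_iff (a b : Ptn) (c : Ptn → ℤ) : IsSchurProduct a b c ↔
    (∀ g : Ptn, g.1 ≠ a.1 + b.1 → c g = 0) ∧
      (jacobiTrudi (a.1 + b.1) (expo (a.1 + b.1) a)).det *
        alternant (a.1 + b.1) (expo (a.1 + b.1) b) =
      ∑ g : Nat.Partition (a.1 + b.1),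
        c ⟨a.1 + b.1, g⟩ • alternant (a.1 + b.1) (expo (a.1 + b.1) ⟨a.1 + b.1, g⟩) := by
  rw [IsSchurProduct]
  refine and_congr_right fun _ => ?_
  set N := a.1 + b.1
  have h1 : ∑ g : Nat.Partition N, c ⟨N, g⟩ • schur N ⟨N, g⟩ =
      algebraMap (MvPolynomial (Fin N) ℤ) (FractionRing (MvPolynomial (Fin N) ℤ))
        (∑ g : Nat.Partition N, c ⟨N, g⟩ • (jacobiTrudi N (expo N ⟨N, g⟩)).det) := by
    rw [map_sum]
    refine Finset.sum_congr rfl fun g _ => ?_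
    rw [schur_eq_det, map_zsmul]
  rw [h1, schur_eq_det, schur_eq_det, ← map_mul,
    (FaithfulSMul.algebraMap_injective (MvPolynomial (Fin N) ℤ)
      (FractionRing (MvPolynomial (Fin N) ℤ))).eq_iff,
    ← mul_left_inj' (alternant_stair_ne_zero N), mul_assoc, ← alternant_eq_det_mul,
    Finset.sum_mul]
  simp only [smul_mul_assoc, ← alternant_eq_det_mul]

lemma exists_isSchurProduct (a b : Ptn) : ∃ c, IsSchurProduct a b c := by
  classical
  simp only [isSchurProduct_iff]
  set N := a.1 + b.1 with hN
  refine ⟨fun g => if g.1 = N then coeff (toFsupp (expo N g))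
    ((jacobiTrudi N (expo N a)).det * alternant N (expo N b)) else 0,
    fun g hg => if_neg hg, ?_⟩
  simp only [if_true]
  apply IsAlternating.eq_sum le_rfl
  · exact (isAlternating_alternant _).mul_symm (isSymmetric_det_jacobiTrudi _ _)
  · have h1 := isHomogeneous_det_jacobiTrudi (sum_expo a (N := N) (by omega))
    have h2 := isHomogeneous_alternant (expo N b)
    rw [sum_expo b (N := N) (by omega)] at h2
    have h3 := h1.mul h2
    rwa [← add_assoc] at h3

lemma isSchurProduct_lrCoeff (a b : Ptn) : IsSchurProduct a b fun g => lrCoeff g a b :=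
  Classical.epsilon_spec (exists_isSchurProduct a b)

lemma lrCoeff_eq_zero {g a b : Ptn} (h : g.1 ≠ a.1 + b.1) : lrCoeff g a b = 0 :=
  (isSchurProduct_lrCoeff a b).1 g h

lemma lrCoeff_comm (g a b : Ptn) : lrCoeff g a b = lrCoeff g b a := by
  -- The number of variables is |a| + |b| on one side and |b| + |a| on the other; a free M equal to
  -- N avoids transport between polynomial rings. Equal predicates have equal `Classical.epsilon`.
  have key : ∀ (c : Ptn → ℤ) (a b : Ptn) (N M : ℕ), N = M →
      ((∀ g : Ptn, g.1 ≠ N → c g = 0) ∧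
        schur N a * schur N b = ∑ g : Nat.Partition N, c ⟨N, g⟩ • schur N ⟨N, g⟩) →
      ((∀ g : Ptn, g.1 ≠ M → c g = 0) ∧
        schur M b * schur M a = ∑ g : Nat.Partition M, c ⟨M, g⟩ • schur M ⟨M, g⟩) := by
    rintro c a b N M rfl ⟨h1, h2⟩
    exact ⟨h1, by rw [mul_comm, h2]⟩
  have : IsSchurProduct a b = IsSchurProduct b a := by
    funext c
    exact propext ⟨key c a b _ _ (add_comm _ _), key c b a _ _ (add_comm _ _)⟩
  rw [lrCoeff, this, lrCoeff]

lemma alternant_mul_alternant (a b : Ptn) :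
    alternant (a.1 + b.1) (expo (a.1 + b.1) a) * alternant (a.1 + b.1) (expo (a.1 + b.1) b) =
      (∑ g : Nat.Partition (a.1 + b.1), lrCoeff ⟨a.1 + b.1, g⟩ a b •
        alternant (a.1 + b.1) (expo (a.1 + b.1) ⟨a.1 + b.1, g⟩)) *
          alternant (a.1 + b.1) (stair (a.1 + b.1)) := by
  rw [← ((isSchurProduct_iff a b _).1 (isSchurProduct_lrCoeff a b)).2]
  nth_rw 1 [alternant_eq_det_mul]
  ring

/-! ### Character values on multisets of cycle lengths -/

/-- The value of the character of `l` at the permutations of cycle type `m`, and `0` if `m` is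
not a partition of the size of `l`. -/
noncomputable def ch (l : Ptn) (m : Multiset ℕ) : ℤ :=
  open Classical in if m.sum = l.1 ∧ ∀ x ∈ m, 0 < x then frobM l.1 l.2 m else 0

lemma ch_eq_zero {l : Ptn} {m : Multiset ℕ} (h : m.sum ≠ l.1) : ch l m = 0 :=
  if_neg fun h' => h h'.1

lemma ch_eq_zero_of_not_pos {l : Ptn} {m : Multiset ℕ} (h : ¬ ∀ x ∈ m, 0 < x) : ch l m = 0 :=
  if_neg fun h' => h h'.2

lemma ch_parts {d : ℕ} (l r : Nat.Partition d) : ch ⟨d, l⟩ r.parts = frobM d l r.parts :=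
  if_pos ⟨r.parts_sum, fun _ hx => r.parts_pos hx⟩

/-- Independence of the number of variables: for each N ≥ d the coefficient is the same rational
character value. -/
lemma frobM_parts {d N : ℕ} (hN : d ≤ N) (l r : Nat.Partition d) :
    frobM N l r.parts = ch ⟨d, l⟩ r.parts := by
  obtain ⟨σ, rfl⟩ := exists_cycPtn_eq r
  rw [ch_parts]
  have h1 := irrChar_eq_frob ℚ hN l σ
  rw [irrChar_eq_frob ℚ le_rfl l σ, frob_eq_frobM, frob_eq_frobM] at h1
  exact (Int.cast_injective h1).symm

lemma irrChar_eq_ch (F : Type*) [Field F] [CharZero F] {d : ℕ} (l : Nat.Partition d)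
    (σ : Equiv.Perm (Fin d)) : irrChar F l σ = (ch ⟨d, l⟩ σ.partition.parts : F) := by
  rw [irrChar_eq_frob F le_rfl l σ, frob_eq_frobM]
  exact congrArg _ (ch_parts l (cycPtn σ)).symm

lemma prod_psum_mul_alternant {d N : ℕ} (hN : d ≤ N) (r : Nat.Partition d) :
    (r.parts.map (psum (Fin N) ℤ)).prod * alternant N (stair N) =
      ∑ l : Nat.Partition d, ch ⟨d, l⟩ r.parts • alternant N (expo N ⟨d, l⟩) := by
  simp_rw [← frobM_parts hN]
  obtain ⟨σ, rfl⟩ := exists_cycPtn_eq r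
  have h := fixPoly_mul_alternant hN σ
  rw [fixPoly_eq_prod_psum] at h
  simp_rw [frob_eq_frobM] at h
  exact h

/-- The union of two partitions. -/
def addPtn {a b : ℕ} (r : Nat.Partition a) (s : Nat.Partition b) : Nat.Partition (a + b) where
  parts := r.parts + s.parts
  parts_pos := fun h => (Multiset.mem_add.1 h).elim (fun h => r.parts_pos h) fun h => s.parts_pos h
  parts_sum := by rw [Multiset.sum_add, r.parts_sum, s.parts_sum]

/-- Restriction of characters to Young subgroups. -/
lemma ch_add {a b : ℕ} (r : Nat.Partition a) (s : Nat.Partition b) (g : Nat.Partition (a + b)) :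
    ch ⟨a + b, g⟩ (r.parts + s.parts) = ∑ x : Nat.Partition a, ∑ y : Nat.Partition b,
      lrCoeff ⟨a + b, g⟩ ⟨a, x⟩ ⟨b, y⟩ * (ch ⟨a, x⟩ r.parts * ch ⟨b, y⟩ s.parts) := by
  revert g
  have h1 := prod_psum_mul_alternant (Nat.le_add_right a b) r
  have h2 := prod_psum_mul_alternant (Nat.le_add_left b a) s
  have h3 := prod_psum_mul_alternant le_rfl (addPtn r s)
  have h4 : (addPtn r s).parts = r.parts + s.parts := rfl
  rw [h4, Multiset.map_add, Multiset.prod_add] at h3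
  set N := a + b with hN
  -- The power sum of the union is the product of the two power sums. One Vandermonde factor for
  -- each of them makes both expandable in alternants.
  have h5 : (∑ g : Nat.Partition N, ch ⟨N, g⟩ (r.parts + s.parts) •
      alternant N (expo N ⟨N, g⟩)) * alternant N (stair N) =
      (∑ g : Nat.Partition N, (∑ x : Nat.Partition a, ∑ y : Nat.Partition b,
      lrCoeff ⟨N, g⟩ ⟨a, x⟩ ⟨b, y⟩ * (ch ⟨a, x⟩ r.parts * ch ⟨b, y⟩ s.parts)) •
      alternant N (expo N ⟨N, g⟩)) * alternant N (stair N) := by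
    rw [← h3]
    calc _ = ((r.parts.map (psum (Fin N) ℤ)).prod * alternant N (stair N)) *
          ((s.parts.map (psum (Fin N) ℤ)).prod * alternant N (stair N)) := by ring
      _ = ∑ x : Nat.Partition a, ∑ y : Nat.Partition b,
          (ch ⟨a, x⟩ r.parts * ch ⟨b, y⟩ s.parts) •
            (alternant N (expo N ⟨a, x⟩) * alternant N (expo N ⟨b, y⟩)) := by
        rw [h1, h2, Finset.sum_mul_sum]
        refine Finset.sum_congr rfl fun x _ => Finset.sum_congr rfl fun y _ => ?_
        rw [smul_mul_smul_comm]
      _ = ∑ x : Nat.Partition a, ∑ y : Nat.Partition b,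
          (ch ⟨a, x⟩ r.parts * ch ⟨b, y⟩ s.parts) •
            ((∑ g : Nat.Partition N, lrCoeff ⟨N, g⟩ ⟨a, x⟩ ⟨b, y⟩ •
              alternant N (expo N ⟨N, g⟩)) * alternant N (stair N)) := by
        refine Finset.sum_congr rfl fun x _ => Finset.sum_congr rfl fun y _ => ?_
        rw [← alternant_mul_alternant ⟨a, x⟩ ⟨b, y⟩]
      _ = _ := by
        simp only [Finset.sum_smul, Finset.sum_mul, Finset.smul_sum, ← smul_mul_assoc]
        rw [Finset.sum_comm' (t' := univ) (s' := fun _ => univ) (by simp)]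
        conv_rhs => rw [Finset.sum_comm]
        rw [Finset.sum_comm]
        refine Finset.sum_congr rfl fun x _ => ?_
        rw [Finset.sum_comm' (t' := univ) (s' := fun _ => univ) (by simp)]
        refine Finset.sum_congr rfl fun g _ => Finset.sum_congr rfl fun y _ => ?_
        rw [smul_smul, mul_comm (lrCoeff _ _ _)]
  have h6 := mul_right_cancel₀ (alternant_stair_ne_zero N) h5
  exact congrFun (alternant_sum_inj le_rfl h6)

/-! ### Orders of centralisers -/

/-- The order of the centraliser of a permutation of cycle type `m`. -/
def zee (m : Multiset ℕ) : ℕ := m.prod * ∏ n ∈ m.toFinset, (m.count n).factorial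

lemma zee_cons (k : ℕ) (m : Multiset ℕ) : zee (k ::ₘ m) = zee m * (k * (m.count k + 1)) := by
  have h1 : ∏ n ∈ m.toFinset, (m.count n).factorial =
      ∏ n ∈ (k ::ₘ m).toFinset, (m.count n).factorial := by
    apply Finset.prod_subset
    · rw [Multiset.toFinset_cons]; exact Finset.subset_insert _ _
    · intro x _ hx
      rw [Multiset.mem_toFinset] at hx
      rw [Multiset.count_eq_zero_of_notMem hx, Nat.factorial_zero]
  have hk : k ∈ (k ::ₘ m).toFinset := by simp
  rw [zee, zee, h1, Multiset.prod_cons, ← Finset.mul_prod_erase _ _ hk,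
    ← Finset.mul_prod_erase _ (fun n => (m.count n).factorial) hk, Multiset.count_cons_self,
    Nat.factorial_succ]
  rw [Finset.prod_congr rfl (g := fun n => (m.count n).factorial)]
  · ring
  · intro n hn
    rw [Multiset.count_cons_of_ne (Finset.ne_of_mem_erase hn)]

lemma zee_add_replicate {m : Multiset ℕ} (h : 1 ∉ m) (j : ℕ) :
    zee (m + Multiset.replicate j 1) = zee m * j.factorial := by
  induction j with
  | zero => simp
  | succ j ih =>
    rw [Multiset.replicate_succ, Multiset.add_cons, zee_cons, ih, Multiset.count_add,
      Multiset.count_replicate_self, Multiset.count_eq_zero_of_notMem h, Nat.factorial_succ]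
    ring

lemma zee_pos {m : Multiset ℕ} (h : ∀ x ∈ m, 0 < x) : 0 < zee m :=
  Nat.mul_pos (Multiset.prod_pos h) (Finset.prod_pos fun _ _ => Nat.factorial_pos _)

/-- `Equiv.Perm.card_of_cycleType_mul_eq` counts by cycle types without fixed points, so the parts
equal to 1 are split off first. -/
lemma classSize_mul_zee {d : ℕ} (r : Nat.Partition d) :
    classSize r * zee r.parts = d.factorial := by
  set m := r.parts.filter (2 ≤ ·) with hm
  have h1 : r.parts = m + Multiset.replicate (d - m.sum) 1 := by
    have h2 : r.parts = m + r.parts.filter (fun x => ¬ 2 ≤ x) :=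
      (Multiset.filter_add_not _ _).symm
    have h3 : r.parts.filter (fun x => ¬ 2 ≤ x) =
        Multiset.replicate (Multiset.card (r.parts.filter (fun x => ¬ 2 ≤ x))) 1 := by
      rw [Multiset.eq_replicate_card]
      intro x hx
      rw [Multiset.mem_filter] at hx
      have := r.parts_pos hx.1
      omega
    have h4 : d = m.sum + Multiset.card (r.parts.filter (fun x => ¬ 2 ≤ x)) := by
      conv_lhs => rw [← r.parts_sum, h2, h3, Multiset.sum_add, Multiset.sum_replicate]
      simp
    rw [h3] at h2
    rwa [show d - m.sum = Multiset.card (r.parts.filter (fun x => ¬ 2 ≤ x)) by omega]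
  have h5 : ∀ a ∈ m, 2 ≤ a := fun a ha => (Multiset.mem_filter.1 ha).2
  have h6 : m.sum ≤ d := by
    have := congrArg Multiset.sum h1
    rw [r.parts_sum, Multiset.sum_add] at this
    omega
  have h7 := Equiv.Perm.card_of_cycleType_mul_eq (Fin d) m
  rw [Fintype.card_fin, if_pos ⟨h6, h5⟩] at h7
  rw [← h7, classSize, h1, zee_add_replicate (fun h => by have := h5 1 h; omega), zee]
  congr 1
  · congr 1
    ext σ
    simp only [Finset.mem_filter_univ]
    rw [Nat.Partition.ext_iff]
    have h8 : (cycPtn σ).parts.filter (2 ≤ ·) = σ.cycleType :=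
      Equiv.Perm.filter_parts_partition_eq_cycleType
    constructor
    · intro h
      rw [← h8, h]
    · intro h
      rw [h1, ← h]
      change σ.partition.parts = _
      rw [Equiv.Perm.parts_partition, Equiv.Perm.sum_cycleType, Fintype.card_fin]
  · ring

/-- Adding a part k to t, it goes to `s` or to `r`. The two cases contribute k times the
multiplicity of k in `s` and in `r`, which add up to the factor in `zee_cons`. -/
lemma count_antidiagonal_mul_zee (t : Multiset ℕ) : ∀ r s : Multiset ℕ, r + s = t →
    t.antidiagonal.count (r, s) * (zee r * zee s) = zee t := by
  induction t using Multiset.induction_on with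
  | empty =>
    intro r s h
    obtain ⟨rfl, rfl⟩ := add_eq_zero.1 h
    simp [zee]
  | cons k t ih =>
    intro r s h
    have hinj1 : Function.Injective (Prod.map id (Multiset.cons k) :
        Multiset ℕ × Multiset ℕ → Multiset ℕ × Multiset ℕ) :=
      Function.injective_id.prodMap fun _ _ h => (Multiset.cons_inj_right k).1 h
    have hinj2 : Function.Injective (Prod.map (Multiset.cons k) id :
        Multiset ℕ × Multiset ℕ → Multiset ℕ × Multiset ℕ) :=
      Function.Injective.prodMap (fun _ _ h => (Multiset.cons_inj_right k).1 h)
        Function.injective_id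
    have h1 : (t.antidiagonal.map (Prod.map id (Multiset.cons k))).count (r, s) *
        (zee r * zee s) = zee t * (k * s.count k) := by
      by_cases hk : k ∈ s
      · obtain ⟨s, rfl⟩ := Multiset.exists_cons_of_mem hk
        have h2 := Multiset.count_map_eq_count' _ t.antidiagonal hinj1 (r, s)
        rw [Prod.map_apply, id] at h2
        rw [Multiset.add_cons, Multiset.cons_inj_right] at h
        rw [h2, zee_cons, ← ih r s h,
          Multiset.count_cons_self]
        ring
      · rw [Multiset.count_eq_zero_of_notMem hk, Multiset.count_eq_zero_of_notMem]
        · simp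
        · intro hmem
          obtain ⟨p, _, hp⟩ := Multiset.mem_map.1 hmem
          apply hk
          have h3 : k ::ₘ p.2 = s := (Prod.ext_iff.1 hp).2
          exact h3 ▸ Multiset.mem_cons_self _ _
    have h1' : (t.antidiagonal.map (Prod.map (Multiset.cons k) id)).count (r, s) *
        (zee r * zee s) = zee t * (k * r.count k) := by
      by_cases hk : k ∈ r
      · obtain ⟨r, rfl⟩ := Multiset.exists_cons_of_mem hk
        have h2 := Multiset.count_map_eq_count' _ t.antidiagonal hinj2 (r, s)
        rw [Prod.map_apply, id] at h2
        rw [Multiset.cons_add, Multiset.cons_inj_right] at h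
        rw [h2, zee_cons, ← ih r s h,
          Multiset.count_cons_self]
        ring
      · rw [Multiset.count_eq_zero_of_notMem hk, Multiset.count_eq_zero_of_notMem]
        · simp
        · intro hmem
          obtain ⟨p, _, hp⟩ := Multiset.mem_map.1 hmem
          apply hk
          have h3 : k ::ₘ p.1 = r := (Prod.ext_iff.1 hp).1
          exact h3 ▸ Multiset.mem_cons_self _ _
    rw [Multiset.antidiagonal_cons, Multiset.count_add, add_mul, h1, h1', zee_cons]
    have h3 := congrArg (Multiset.count k) h
    rw [Multiset.count_add, Multiset.count_cons_self] at h3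
    rw [← h3]
    ring

end TypeI

namespace TypeI
open Finset

/-! ### Induction and restriction of characters -/

lemma sum_ptnsLE {M : Type*} [AddCommMonoid M] {D a : ℕ} (ha : a ≤ D) {f : Ptn → M}
    (hf : ∀ x : Ptn, x.1 ≠ a → f x = 0) :
    ∑ x ∈ ptnsLE D, f x = ∑ x : Nat.Partition a, f ⟨a, x⟩ := by
  rw [ptnsLE, Finset.sum_sigma, Finset.sum_eq_single a]
  · intro b _ hb
    exact Finset.sum_eq_zero fun x _ => hf _ hb
  · intro h
    simp only [Finset.mem_range] at h
    omega

lemma mem_ptnsLE {D : ℕ} {x : Ptn} : x ∈ ptnsLE D ↔ x.1 ≤ D := by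
  simp [ptnsLE]

lemma exists_parts_eq {m : Multiset ℕ} {a : ℕ} (hs : m.sum = a) (hp : ∀ x ∈ m, 0 < x) :
    ∃ r : Nat.Partition a, r.parts = m := ⟨⟨m, fun h => hp _ h, hs⟩, rfl⟩

theorem sum_lrCoeff_mul_ch_mul_ch {D : ℕ} {g : Ptn} (hg : g.1 ≤ D) (r s : Multiset ℕ) :
    ∑ x ∈ ptnsLE D, ∑ y ∈ ptnsLE D, lrCoeff g x y * (ch x r * ch y s) = ch g (r + s) := by
  by_cases hpos : ∀ x ∈ r + s, 0 < x
  · by_cases hsum : (r + s).sum = g.1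
    · obtain ⟨R, hR⟩ := exists_parts_eq (m := r) rfl
        fun x hx => hpos x (Multiset.mem_add.2 (Or.inl hx))
      obtain ⟨S, hS⟩ := exists_parts_eq (m := s) rfl
        fun x hx => hpos x (Multiset.mem_add.2 (Or.inr hx))
      rw [Multiset.sum_add] at hsum
      obtain ⟨n, g⟩ := g
      dsimp only at hsum hg
      subst hsum
      have h := ch_add R S g
      rw [hR, hS] at h
      rw [h, sum_ptnsLE (a := r.sum) (by omega)]
      · refine Finset.sum_congr rfl fun x _ => ?_
        rw [sum_ptnsLE (a := s.sum) (by omega)]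
        intro y hy
        rw [ch_eq_zero (l := y) hy.symm, mul_zero, mul_zero]
      · intro x hx
        refine Finset.sum_eq_zero fun y _ => ?_
        rw [ch_eq_zero (l := x) hx.symm, zero_mul, mul_zero]
    · rw [ch_eq_zero hsum]
      refine Finset.sum_eq_zero fun x _ => Finset.sum_eq_zero fun y _ => ?_
      by_cases hx : r.sum = x.1
      · by_cases hy : s.sum = y.1
        · rw [lrCoeff_eq_zero, zero_mul]
          rw [← hx, ← hy, ← Multiset.sum_add]
          exact Ne.symm hsum
        · rw [ch_eq_zero hy, mul_zero, mul_zero]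
      · rw [ch_eq_zero hx, zero_mul, mul_zero]
  · rw [ch_eq_zero_of_not_pos hpos]
    refine Finset.sum_eq_zero fun x _ => Finset.sum_eq_zero fun y _ => ?_
    by_cases hr : ∀ x ∈ r, 0 < x
    · rw [ch_eq_zero_of_not_pos (l := y) (m := s), mul_zero, mul_zero]
      intro hs
      exact hpos fun x hx => (Multiset.mem_add.1 hx).elim (hr x) (hs x)
    · rw [ch_eq_zero_of_not_pos hr, zero_mul, mul_zero]

lemma sum_ch_mul_ch_div {d : ℕ} (l m : Nat.Partition d) :
    ∑ r : Nat.Partition d, (ch ⟨d, l⟩ r.parts : ℚ) * ch ⟨d, m⟩ r.parts / zee r.parts =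
      if l = m then 1 else 0 := by
  have hd : (d.factorial : ℚ) ≠ 0 := Nat.cast_ne_zero.2 d.factorial_ne_zero
  have h := congrArg (fun z : ℤ => (z : ℚ) / d.factorial) (sum_classSize_mul le_rfl l m)
  simp only [Int.cast_sum, Finset.sum_div, ← ch_parts] at h
  rw [show (if l = m then (1 : ℚ) else 0) =
    ((if l = m then (d.factorial : ℤ) else 0 : ℤ) : ℚ) / d.factorial by
      split_ifs <;> simp [hd], ← h]
  refine Finset.sum_congr rfl fun r _ => ?_
  have hz : (zee r.parts : ℚ) ≠ 0 :=
    Nat.cast_ne_zero.2 (zee_pos fun x hx => r.parts_pos hx).ne'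
  rw [← classSize_mul_zee r] at hd ⊢
  push_cast at hd ⊢
  have hc := left_ne_zero_of_mul hd
  field_simp

lemma sum_ch_mul_ch {d : ℕ} (r t : Nat.Partition d) :
    ∑ l : Nat.Partition d, (ch ⟨d, l⟩ r.parts : ℚ) * ch ⟨d, l⟩ t.parts =
      if r = t then (zee t.parts : ℚ) else 0 := by
  have h := congrArg (Int.cast : ℤ → ℚ) (sum_frobM_mul_frobM le_rfl r t)
  simp only [← ch_parts, Int.cast_mul, Int.cast_sum, Int.cast_natCast] at h
  have hc : (classSize t : ℚ) ≠ 0 := Nat.cast_ne_zero.2 (classSize_ne_zero t)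
  apply mul_right_cancel₀ hc
  rw [h]
  split_ifs
  · rw [← classSize_mul_zee t]; push_cast; ring
  · simp

/-- Inverts the restriction formula by the first orthogonality relation in both variables. -/
lemma lrCoeff_eq_sum_ch {a b : ℕ} (x : Nat.Partition a) (y : Nat.Partition b)
    (g : Nat.Partition (a + b)) : (lrCoeff ⟨a + b, g⟩ ⟨a, x⟩ ⟨b, y⟩ : ℚ) =
      ∑ r : Nat.Partition a, ∑ s : Nat.Partition b,
        (ch ⟨a, x⟩ r.parts : ℚ) * ch ⟨b, y⟩ s.parts * ch ⟨a + b, g⟩ (r.parts + s.parts) /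
          (zee r.parts * zee s.parts) := by
  have h1 : ∀ (r : Nat.Partition a) (s : Nat.Partition b),
      (ch ⟨a, x⟩ r.parts : ℚ) * ch ⟨b, y⟩ s.parts * ch ⟨a + b, g⟩ (r.parts + s.parts) /
          (zee r.parts * zee s.parts) =
      ∑ x' : Nat.Partition a, ∑ y' : Nat.Partition b,
        (lrCoeff ⟨a + b, g⟩ ⟨a, x'⟩ ⟨b, y'⟩ : ℚ) *
          (((ch ⟨a, x⟩ r.parts : ℚ) * ch ⟨a, x'⟩ r.parts / zee r.parts) *
          ((ch ⟨b, y⟩ s.parts : ℚ) * ch ⟨b, y'⟩ s.parts / zee s.parts)) := by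
    intro r s
    rw [ch_add, Int.cast_sum, Finset.mul_sum, Finset.sum_div]
    refine Finset.sum_congr rfl fun x' _ => ?_
    rw [Int.cast_sum, Finset.mul_sum, Finset.sum_div]
    refine Finset.sum_congr rfl fun y' _ => ?_
    push_cast
    ring
  simp_rw [h1]
  have h2 : ∑ r : Nat.Partition a, ∑ s : Nat.Partition b, ∑ x' : Nat.Partition a,
      ∑ y' : Nat.Partition b, (lrCoeff ⟨a + b, g⟩ ⟨a, x'⟩ ⟨b, y'⟩ : ℚ) *
          (((ch ⟨a, x⟩ r.parts : ℚ) * ch ⟨a, x'⟩ r.parts / zee r.parts) *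
          ((ch ⟨b, y⟩ s.parts : ℚ) * ch ⟨b, y'⟩ s.parts / zee s.parts)) =
      ∑ x' : Nat.Partition a, ∑ y' : Nat.Partition b,
        (lrCoeff ⟨a + b, g⟩ ⟨a, x'⟩ ⟨b, y'⟩ : ℚ) * ((∑ r : Nat.Partition a,
          (ch ⟨a, x⟩ r.parts : ℚ) * ch ⟨a, x'⟩ r.parts / zee r.parts) *
        ∑ s : Nat.Partition b, (ch ⟨b, y⟩ s.parts : ℚ) * ch ⟨b, y'⟩ s.parts / zee s.parts) := by
    simp_rw [Finset.sum_mul_sum, Finset.mul_sum]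
    calc _ = ∑ r : Nat.Partition a, ∑ x' : Nat.Partition a, ∑ s : Nat.Partition b,
          ∑ y' : Nat.Partition b, _ := Finset.sum_congr rfl fun r _ => Finset.sum_comm
      _ = ∑ x' : Nat.Partition a, ∑ r : Nat.Partition a, ∑ s : Nat.Partition b,
          ∑ y' : Nat.Partition b, _ := Finset.sum_comm
      _ = ∑ x' : Nat.Partition a, ∑ r : Nat.Partition a, ∑ y' : Nat.Partition b,
          ∑ s : Nat.Partition b, _ :=
        Finset.sum_congr rfl fun x' _ => Finset.sum_congr rfl fun r _ => Finset.sum_comm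
      _ = _ := Finset.sum_congr rfl fun x' _ => Finset.sum_comm
  rw [h2]
  simp_rw [sum_ch_mul_ch_div]
  simp

/-- Replaces splittings counted with multiplicity by pairs of partitions with weight z_t / (z_r
z_s). -/
lemma sum_antidiagonal_eq {a b : ℕ} {t : Multiset ℕ} (ht : ∀ x ∈ t, 0 < x)
    {f : Multiset ℕ → Multiset ℕ → ℚ}
    (hf : ∀ r s, f r s ≠ 0 → r.sum = a ∧ s.sum = b) :
    (t.antidiagonal.map fun p => f p.1 p.2).sum =
      ∑ r : Nat.Partition a, ∑ s : Nat.Partition b,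
        if r.parts + s.parts = t then f r.parts s.parts * zee t / (zee r.parts * zee s.parts)
        else 0 := by
  rw [Finset.sum_multiset_map_count, ← Finset.sum_product', ← Finset.sum_filter]
  symm
  refine Finset.sum_of_injOn (fun p : Nat.Partition a × Nat.Partition b => (p.1.parts, p.2.parts))
    ?_ ?_ ?_ ?_
  · rintro ⟨r, s⟩ _ ⟨r', s'⟩ _ h
    simp only [Prod.mk.injEq] at h
    exact Prod.ext (Nat.Partition.ext h.1) (Nat.Partition.ext h.2)
  · rintro ⟨r, s⟩ h
    simpa using h
  · rintro ⟨r, s⟩ hmem hnot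
    by_contra hne
    have h1 := hf r s (fun h => hne (by simp [h]))
    simp only [Multiset.mem_toFinset, Multiset.mem_antidiagonal] at hmem
    obtain ⟨R, hR⟩ := exists_parts_eq h1.1
      fun x hx => ht x (hmem ▸ Multiset.mem_add.2 (Or.inl hx))
    obtain ⟨S, hS⟩ := exists_parts_eq h1.2
      fun x hx => ht x (hmem ▸ Multiset.mem_add.2 (Or.inr hx))
    apply hnot
    refine ⟨(R, S), ?_, ?_⟩
    · simp [hR, hS, hmem]
    · simp [hR, hS]
  · rintro ⟨r, s⟩ h
    simp only [Finset.mem_filter, Finset.mem_product, Finset.mem_univ, true_and] at h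
    have h1 := count_antidiagonal_mul_zee t r.parts s.parts h
    have hz : ∀ {n : ℕ} (q : Nat.Partition n), (zee q.parts : ℚ) ≠ 0 := fun q =>
      Nat.cast_ne_zero.2 (zee_pos fun x hx => q.parts_pos hx).ne'
    have hr := hz r
    have hs := hz s
    rw [← h1, nsmul_eq_mul]
    push_cast
    field_simp

/-- Induction of characters from Young subgroups. -/
theorem sum_lrCoeff_mul_ch {D : ℕ} {t : Multiset ℕ} (ht : t.sum ≤ D) (x y : Ptn) :
    ∑ g ∈ ptnsLE D, lrCoeff g x y * ch g t =
      (t.antidiagonal.map fun p => ch x p.1 * ch y p.2).sum := by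
  by_cases hpos : ∀ k ∈ t, 0 < k
  · by_cases hsum : t.sum = x.1 + y.1
    · obtain ⟨a, x⟩ := x
      obtain ⟨b, y⟩ := y
      dsimp only at hsum
      obtain ⟨T, rfl⟩ := exists_parts_eq hsum hpos
      rw [sum_ptnsLE (hsum ▸ ht) (fun g hg => by rw [lrCoeff_eq_zero hg, zero_mul])]
      have h2 : ((T.parts.antidiagonal.map fun p =>
          ch ⟨a, x⟩ p.1 * ch ⟨b, y⟩ p.2).sum : ℚ) =
          (T.parts.antidiagonal.map fun p =>
            (ch ⟨a, x⟩ p.1 : ℚ) * ch ⟨b, y⟩ p.2).sum := by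
        rw [Int.cast_multiset_sum, Multiset.map_map]
        simp
      have h3 := sum_antidiagonal_eq (a := a) (b := b) hpos
        (f := fun r s => (ch ⟨a, x⟩ r : ℚ) * ch ⟨b, y⟩ s) (by
          intro r s h
          constructor
          · by_contra h'
            rw [ch_eq_zero (l := ⟨a, x⟩) h'] at h
            simp at h
          · by_contra h'
            rw [ch_eq_zero (l := ⟨b, y⟩) h'] at h
            simp at h)
      have h4 : ((∑ g : Nat.Partition (a + b),
          lrCoeff ⟨a + b, g⟩ ⟨a, x⟩ ⟨b, y⟩ * ch ⟨a + b, g⟩ T.parts : ℤ) : ℚ) =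
          ((T.parts.antidiagonal.map fun p => ch ⟨a, x⟩ p.1 * ch ⟨b, y⟩ p.2).sum : ℤ) := by
        rw [h2, h3]
        push_cast
        simp_rw [lrCoeff_eq_sum_ch, Finset.sum_mul]
        rw [Finset.sum_comm]
        refine Finset.sum_congr rfl fun r _ => ?_
        rw [Finset.sum_comm]
        refine Finset.sum_congr rfl fun s _ => ?_
        -- After the coefficient is written by characters, the sum over `g` collapses by the second
        -- orthogonality relation to the pairs with r + s = T.
        have h5 := sum_ch_mul_ch (addPtn r s) T
        have h6 : (addPtn r s).parts = r.parts + s.parts := rfl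
        rw [h6] at h5
        have h7 : (addPtn r s = T) ↔ r.parts + s.parts = T.parts := by
          rw [Nat.Partition.ext_iff, h6]
        calc _ = (ch ⟨a, x⟩ r.parts : ℚ) * ch ⟨b, y⟩ s.parts / (zee r.parts * zee s.parts) *
              ∑ g : Nat.Partition (a + b),
                (ch ⟨a + b, g⟩ (r.parts + s.parts) : ℚ) * ch ⟨a + b, g⟩ T.parts := by
              rw [Finset.mul_sum]
              exact Finset.sum_congr rfl fun g _ => by ring
          _ = _ := by
              rw [h5]
              simp only [h7]
              split_ifs <;> ring
      exact_mod_cast h4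
    · rw [Finset.sum_eq_zero]
      · symm
        apply Multiset.sum_eq_zero
        intro z hz
        obtain ⟨p, hp, rfl⟩ := Multiset.mem_map.1 hz
        rw [Multiset.mem_antidiagonal] at hp
        by_cases hx : p.1.sum = x.1
        · rw [ch_eq_zero (l := y), mul_zero]
          intro hy
          apply hsum
          rw [← hp, Multiset.sum_add, hx, hy]
        · rw [ch_eq_zero hx, zero_mul]
      · intro g _
        by_cases hg : t.sum = g.1
        · rw [lrCoeff_eq_zero (hg ▸ hsum), zero_mul]
        · rw [ch_eq_zero hg, mul_zero]
  · rw [Finset.sum_eq_zero fun g _ => by rw [ch_eq_zero_of_not_pos hpos, mul_zero]]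
    symm
    apply Multiset.sum_eq_zero
    intro z hz
    obtain ⟨p, hp, rfl⟩ := Multiset.mem_map.1 hz
    rw [Multiset.mem_antidiagonal] at hp
    by_cases hr : ∀ k ∈ p.1, 0 < k
    · rw [ch_eq_zero_of_not_pos (l := y), mul_zero]
      intro hs
      exact hpos fun k hk => (Multiset.mem_add.1 (hp ▸ hk)).elim (hr k) (hs k)
    · rw [ch_eq_zero_of_not_pos hr, zero_mul]

/-! ### The Type I matrix -/

/-- A recursion uniform in the length. The two-term case of the definition fits it by symmetry of
the Littlewood-Richardson coefficient. -/
lemma genLRCoeff_cons {D : ℕ} {g : Ptn} (hg : g.1 ≤ D) (b c : Ptn) (bs : List Ptn) :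
    genLRCoeff (b :: c :: bs) g = ∑ a ∈ ptnsLE D, lrCoeff g a b * genLRCoeff (c :: bs) a := by
  cases bs with
  | nil =>
    rw [genLRCoeff, lrCoeff_comm]
    simp only [genLRCoeff]
    by_cases hc : c.1 ≤ D
    · simp [mem_ptnsLE, hc]
    -- Here |c| > D ≥ |g|, so the sizes cannot match and both sides vanish.
    · rw [lrCoeff_eq_zero (by omega)]
      simp [mem_ptnsLE, hc]
  | cons e bs =>
    rw [genLRCoeff]
    apply Finset.sum_subset
    · intro x hx
      rw [mem_ptnsLE] at *
      omega
    · intro x _ hx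
      rw [mem_ptnsLE] at hx
      rw [lrCoeff_eq_zero (by omega), zero_mul]

/-- The Type I matrix with rows and columns indexed by the partitions of all integers. -/
noncomputable def typeIAux (n D : ℕ) (l m : Ptn) : ℤ :=
  ∑ b ∈ Fintype.piFinset fun _ : Fin n => ptnsLE D,
    genLRCoeff (List.ofFn b) l * genLRCoeff (List.ofFn b) m

lemma sum_piFinset_succ {α M : Type*} [AddCommMonoid M] (S : Finset α) (n : ℕ)
    (f : (Fin (n + 1) → α) → M) :
    ∑ b ∈ Fintype.piFinset fun _ : Fin (n + 1) => S, f b =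
      ∑ x ∈ S, ∑ b ∈ Fintype.piFinset fun _ : Fin n => S, f (Fin.cons x b) := by
  rw [← Finset.sum_product']
  refine Finset.sum_bij' (fun b _ => (b 0, Fin.tail b)) (fun p _ => Fin.cons p.1 p.2) ?_ ?_ ?_ ?_ ?_
  · intro b hb
    rw [Fintype.mem_piFinset] at hb
    rw [Finset.mem_product, Fintype.mem_piFinset]
    exact ⟨hb 0, fun i => hb i.succ⟩
  · rintro ⟨x, b⟩ hb
    rw [Finset.mem_product, Fintype.mem_piFinset] at hb
    rw [Fintype.mem_piFinset]
    intro i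
    refine Fin.cases ?_ (fun j => ?_) i
    · exact hb.1
    · exact hb.2 j
  · intro b _; exact Fin.cons_self_tail b
  · rintro ⟨x, b⟩ _; simp
  · intro b _; simp [Fin.cons_self_tail]

lemma typeIAux_one {D : ℕ} {l m : Ptn} (hl : l.1 ≤ D) :
    typeIAux 1 D l m = if l = m then 1 else 0 := by
  rw [typeIAux, sum_piFinset_succ]
  simp only [List.ofFn_succ, Fin.cons_zero, List.ofFn_zero, genLRCoeff]
  rw [Finset.sum_eq_single l]
  · simp [eq_comm]
  · intro x _ hx
    simp [hx.symm]
  · intro h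
    exact (h (mem_ptnsLE.2 hl)).elim

lemma typeIAux_succ {n D : ℕ} {l m : Ptn} (hl : l.1 ≤ D) (hm : m.1 ≤ D) :
    typeIAux (n + 2) D l m = ∑ x ∈ ptnsLE D, ∑ a ∈ ptnsLE D, ∑ a' ∈ ptnsLE D,
      lrCoeff l a x * typeIAux (n + 1) D a a' * lrCoeff m a' x := by
  rw [typeIAux, sum_piFinset_succ]
  refine Finset.sum_congr rfl fun x _ => ?_
  have h1 : ∀ b : Fin (n + 1) → Ptn, ∀ g : Ptn, g.1 ≤ D →
      genLRCoeff (List.ofFn (Fin.cons x b : Fin (n + 2) → Ptn)) g =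
        ∑ a ∈ ptnsLE D, lrCoeff g a x * genLRCoeff (List.ofFn b) a := by
    intro b g hg
    rw [List.ofFn_cons, List.ofFn_succ]
    exact genLRCoeff_cons hg _ _ _
  simp_rw [h1 _ l hl, h1 _ m hm, Finset.sum_mul_sum, typeIAux, Finset.mul_sum, Finset.sum_mul]
  rw [Finset.sum_comm]
  refine Finset.sum_congr rfl fun a _ => ?_
  rw [Finset.sum_comm]
  refine Finset.sum_congr rfl fun a' _ => Finset.sum_congr rfl fun b _ => ?_
  ring

/-- Expanding the product of n + 1 over the parts: each part contributes n if it goes left and 1 if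
it goes right. -/
lemma sum_antidiagonal_pow (n : ℕ) (t : Multiset ℕ) :
    ((t.antidiagonal.map fun p => (n : ℤ) ^ Multiset.card p.1).sum) =
      ((n + 1 : ℕ) : ℤ) ^ Multiset.card t := by
  have h := Multiset.prod_map_add (s := t) (f := fun _ => (n : ℤ)) (g := fun _ => 1)
  simp only [Multiset.map_const', Multiset.prod_replicate, one_pow, mul_one] at h
  rw [← h]
  push_cast
  rfl

/-- For n + 1 = 1 the matrix is the identity. The inductive step is induction of characters, the
hypothesis on the left part of each splitting, restriction, and the binomial theorem. Working with
all sizes up to `D` lets the hypothesis apply to smaller partitions. -/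
theorem sum_typeIAux_mul_ch (n : ℕ) {D : ℕ} {l : Ptn} (hl : l.1 ≤ D) {t : Multiset ℕ}
    (ht : t.sum ≤ D) : ∑ m ∈ ptnsLE D, typeIAux (n + 1) D l m * ch m t =
      ((n + 1 : ℕ) : ℤ) ^ Multiset.card t * ch l t := by
  induction n generalizing l t with
  | zero =>
    simp_rw [zero_add, typeIAux_one hl]
    simp [mem_ptnsLE, hl]
  | succ n ih =>
    have hle : ∀ p ∈ t.antidiagonal, p.1.sum ≤ D := by
      intro p hp
      rw [Multiset.mem_antidiagonal] at hp
      rw [← hp, Multiset.sum_add] at ht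
      omega
    calc ∑ m ∈ ptnsLE D, typeIAux (n + 2) D l m * ch m t
        = ∑ m ∈ ptnsLE D, ∑ x ∈ ptnsLE D, ∑ a ∈ ptnsLE D, ∑ a' ∈ ptnsLE D,
            lrCoeff l a x * typeIAux (n + 1) D a a' * (lrCoeff m a' x * ch m t) := by
          refine Finset.sum_congr rfl fun m hm => ?_
          rw [typeIAux_succ hl (mem_ptnsLE.1 hm)]
          simp_rw [Finset.sum_mul, mul_assoc]
      _ = ∑ x ∈ ptnsLE D, ∑ a ∈ ptnsLE D, ∑ a' ∈ ptnsLE D,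
            lrCoeff l a x * typeIAux (n + 1) D a a' *
              ∑ m ∈ ptnsLE D, lrCoeff m a' x * ch m t := by
          rw [Finset.sum_comm]
          refine Finset.sum_congr rfl fun x _ => ?_
          rw [Finset.sum_comm]
          refine Finset.sum_congr rfl fun a _ => ?_
          rw [Finset.sum_comm]
          refine Finset.sum_congr rfl fun a' _ => ?_
          rw [Finset.mul_sum]
      _ = ∑ x ∈ ptnsLE D, ∑ a ∈ ptnsLE D, ∑ a' ∈ ptnsLE D, ∑ p ∈ t.antidiagonal.toFinset,
            (t.antidiagonal.count p : ℤ) * (lrCoeff l a x * ch x p.2 *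
              (typeIAux (n + 1) D a a' * ch a' p.1)) := by
          refine Finset.sum_congr rfl fun x _ => Finset.sum_congr rfl fun a _ =>
            Finset.sum_congr rfl fun a' _ => ?_
          rw [sum_lrCoeff_mul_ch ht, Finset.sum_multiset_map_count, Finset.mul_sum]
          refine Finset.sum_congr rfl fun p _ => ?_
          rw [nsmul_eq_mul]
          ring
      _ = ∑ p ∈ t.antidiagonal.toFinset, (t.antidiagonal.count p : ℤ) *
            (((n + 1 : ℕ) : ℤ) ^ Multiset.card p.1 * ∑ a ∈ ptnsLE D, ∑ x ∈ ptnsLE D,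
              lrCoeff l a x * (ch a p.1 * ch x p.2)) := by
          have h1 : ∀ x, ∀ a ∈ ptnsLE D, ∑ a' ∈ ptnsLE D, ∑ p ∈ t.antidiagonal.toFinset,
              (t.antidiagonal.count p : ℤ) * (lrCoeff l a x * ch x p.2 *
                (typeIAux (n + 1) D a a' * ch a' p.1)) =
              ∑ p ∈ t.antidiagonal.toFinset, (t.antidiagonal.count p : ℤ) *
                (((n + 1 : ℕ) : ℤ) ^ Multiset.card p.1 *
                  (lrCoeff l a x * (ch a p.1 * ch x p.2))) := by
            intro x a ha
            rw [Finset.sum_comm]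
            refine Finset.sum_congr rfl fun p hp => ?_
            rw [← Finset.mul_sum, ← Finset.mul_sum,
              ih (mem_ptnsLE.1 ha) (hle p (Multiset.mem_toFinset.1 hp))]
            ring
          rw [Finset.sum_congr rfl fun x _ => Finset.sum_congr rfl fun a ha => h1 x a ha,
            Finset.sum_comm]
          simp_rw [Finset.mul_sum]
          rw [Finset.sum_congr rfl fun a _ => Finset.sum_comm]
          exact Finset.sum_comm
      _ = ∑ p ∈ t.antidiagonal.toFinset, (t.antidiagonal.count p : ℤ) *
            (((n + 1 : ℕ) : ℤ) ^ Multiset.card p.1 * ch l t) := by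
          refine Finset.sum_congr rfl fun p hp => ?_
          rw [Multiset.mem_toFinset, Multiset.mem_antidiagonal] at hp
          rw [sum_lrCoeff_mul_ch_mul_ch hl, hp]
      _ = _ := by
          rw [← sum_antidiagonal_pow, Finset.sum_multiset_map_count, Finset.sum_mul]
          refine Finset.sum_congr rfl fun p _ => ?_
          rw [nsmul_eq_mul]
          ring

/-- If all characters vanished at σ, the diagonal second orthogonality relation would give d! = 0.
-/
lemma exists_irrChar_ne_zero (F : Type*) [Field F] [CharZero F] {d : ℕ}
    (σ : Equiv.Perm (Fin d)) : ∃ l : Nat.Partition d, irrChar F l σ ≠ 0 := by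
  by_contra! h
  have h1 := sum_frobM_mul_frobM le_rfl (cycPtn σ) (cycPtn σ)
  rw [if_pos rfl, Finset.sum_eq_zero, zero_mul] at h1
  · exact d.factorial_ne_zero (by exact_mod_cast h1.symm)
  · intro l _
    have h2 := h l
    rw [irrChar_eq_frob F le_rfl, frob_eq_frobM] at h2
    have h3 : frobM d l (cycPtn σ).parts = 0 := by exact_mod_cast h2
    rw [h3, zero_mul]

end TypeI

theorem theorem9p5 (F : Type*) [Field F] [IsAlgClosed F] [CharZero F] (n d : ℕ) (hn : 1 ≤ n)
    (σ : Equiv.Perm (Fin d)) (p : ℕ) (hp : Multiset.card σ.partition.parts = p) :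
    Module.End.HasEigenvector
      (Matrix.mulVecLin ((TypeI.typeIMatrix n d).map (Int.cast : ℤ → F)))
      ((n : F) ^ p) (fun l : Nat.Partition d => TypeI.irrChar F l σ) := by
  obtain ⟨n, rfl⟩ := Nat.exists_eq_add_of_le' hn
  subst hp
  rw [Module.End.hasEigenvector_iff, Module.End.mem_eigenspace_iff]
  refine ⟨?_, fun h => ?_⟩
  · funext l
    have hsum : σ.partition.parts.sum = d := (TypeI.cycPtn σ).parts_sum
    have h := TypeI.sum_typeIAux_mul_ch n (l := ⟨d, l⟩) le_rfl hsum.le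
    -- Only partitions of d contribute, since `ch` vanishes when sizes differ; this recovers the
    -- matrix indexed by partitions of d.
    rw [TypeI.sum_ptnsLE (le_refl d) (fun m hm => by
      rw [TypeI.ch_eq_zero (hsum.trans_ne (Ne.symm hm)), mul_zero])] at h
    have h2 := congrArg (Int.cast : ℤ → F) h
    rw [Int.cast_sum] at h2
    rw [Matrix.mulVecLin_apply, Matrix.mulVec, dotProduct, Pi.smul_apply, smul_eq_mul,
      TypeI.irrChar_eq_ch]
    push_cast at h2
    rw [Nat.cast_add, Nat.cast_one, ← h2]
    refine Finset.sum_congr rfl fun m _ => ?_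
    rw [TypeI.irrChar_eq_ch]
    rfl
  · obtain ⟨l, hl⟩ := TypeI.exists_irrChar_ne_zero F σ
    exact hl (congrFun h l)
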